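/- All graphs are finite and simple, and eigenvalues of a graph are the eigenvalues of its adjacency matrix. A connected graph $X$ of diameter $d$ is *distance-regular* if there are numbers $a_i,b_i,c_i$ ($0\le i\le d$) such that for all vertices $v,w$ at distance $i$, the vertex $w$ has exactly $a_i$, $b_i$, $c_i$ neighbours at distance $i$, $i+1$, $i-1$ from $v$, respectively. Put $k=b_0$ (the vertex degree) and $\mu=c_2$. A *Delsarte clique* of $X$ is a clique with exactly $1-k/\theta_{\min}$ vertices, where $\theta_{\min}$ is the smallest eigenvalue of $X$; $X$ is *geometric* if there is a collection $\mathcal C$ of Delsarte cliques such that every edge of $X$ lies in exactly one member of $\mathcal C$. The *zero-weight spectral radius* of a $k$-regular graph $X$ on $n$ vertices with eigenvalues $k=\xi_1\ge\xi_2\ge\dots\ge\xi_n$ (with multiplicity) is $\xi(X)=\max_{2\le i\le n}|\xi_i|$. The *motion* of $X$, $\mathrm{motion}(X)$, is the minimum, over all non-identity automorphisms of $X$, of the number of vertices that are not fixed ($+\infty$ if there is no non-identity automorphism). For $d\ge 2$, call a pair of real numbers $\varepsilon>0$, $\eta>0$ *spectral-gap constants for $d$* if for every distance-regular graph $X$ of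 diameter $d$ at least one of the following holds: (1) $b_i>\varepsilon k$ and $c_{i+1}>\varepsilon k$ for some $0\le i\le d-1$; (2) $\xi(X)\le k(1-\eta)$. **Theorem 5.7.** Let $d\ge 2$. There exist spectral-gap constants $\varepsilon,\eta$ for $d$ with $\eta<1/2$. Moreover, let $\varepsilon,\eta$ be any spectral-gap constants for $d$ with $\eta<1/2$, and let $X$ be a geometric distance-regular graph of diameter $d$ on $n$ vertices with $\mu=1$ and smallest eigenvalue $-m$, where $m\ge 3$. Assume that $c_t\le\varepsilon k$ and $b_t\le\varepsilon k$ for some $t\in\{1,\dots,d\}$, and that $k\ge\max(4m/\eta,\;m^2)$. Then $$\mathrm{motion}(X)\ge\frac{\eta}{4}\,n .$$ -/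

import Mathlib

universe u

/-- `G` is a connected graph of diameter `d` which is distance-regular with intersection numbers
`a i`, `b i`, `c i` (`0 ≤ i ≤ d`): for vertices `v`, `w` at distance `i`, the vertex `w` has
exactly `a i`, `b i`, `c i` neighbours at distance `i`, `i + 1`, `i - 1` from `v`, respectively.
The vertex degree is `k = b 0`, and `μ = c 2`. The values at indices `i > d` play no role. -/
structure IsDistanceRegular {V : Type*} (G : SimpleGraph V) (d : ℕ) (a b c : ℕ → ℕ) : Prop where
  connected : G.Connected
  diam_eq : G.diam = d
  card_a : ∀ v w, {x | G.Adj w x ∧ G.dist v x = G.dist v w}.ncard = a (G.dist v w)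
  card_b : ∀ v w, {x | G.Adj w x ∧ G.dist v x = G.dist v w + 1}.ncard = b (G.dist v w)
  card_c : ∀ v w, {x | G.Adj w x ∧ G.dist v x + 1 = G.dist v w}.ncard = c (G.dist v w)

open Classical in
/-- The adjacency matrix of `G`, as a real matrix. -/
noncomputable def realAdjMatrix {V : Type*} [Fintype V] (G : SimpleGraph V) : Matrix V V ℝ :=
  G.adjMatrix ℝ

theorem isHermitian_realAdjMatrix {V : Type*} [Fintype V] (G : SimpleGraph V) :
    (realAdjMatrix G).IsHermitian := by
  classical
  unfold realAdjMatrix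
  rw [Matrix.IsHermitian, Matrix.conjTranspose_eq_transpose_of_trivial]
  exact G.transpose_adjMatrix

open Classical in
/-- `θ` is the smallest eigenvalue of (the adjacency matrix of) `G`. -/
def IsSmallestEigenvalue {V : Type*} [Fintype V] (G : SimpleGraph V) (θ : ℝ) : Prop :=
  IsLeast (spectrum ℝ (realAdjMatrix G)) θ

open Classical in
/-- The zero-weight spectral radius `max {|ξ_i| : 2 ≤ i ≤ n}`, where `ξ_1 ≥ ξ_2 ≥ ⋯ ≥ ξ_n` are the
eigenvalues of `G` listed with multiplicity (in the code the indices start from `0`). -/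
noncomputable def zeroWeightSpectralRadius {V : Type*} [Fintype V] (G : SimpleGraph V) : ℝ :=
  ⨆ i : {i : Fin (Fintype.card V) // 1 ≤ i.val},
    |(isHermitian_realAdjMatrix G).eigenvalues₀ i.val|

/-- `C` is a Delsarte clique of a `k`-regular graph `G` with smallest eigenvalue `θ`. -/
def IsDelsarteClique {V : Type*} (G : SimpleGraph V) (k : ℕ) (θ : ℝ) (C : Finset V) : Prop :=
  G.IsClique (C : Set V) ∧ (C.card : ℝ) = 1 - (k : ℝ) / θ

/-- The `k`-regular (distance-regular) graph `G` is geometric: there is a collection `𝒞` of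
Delsarte cliques such that every edge lies in exactly one member of `𝒞`. -/
def IsGeometric {V : Type*} [Fintype V] (G : SimpleGraph V) (k : ℕ) : Prop :=
  ∃ θ : ℝ, IsSmallestEigenvalue G θ ∧
    ∃ 𝒞 : Set (Finset V), (∀ C ∈ 𝒞, IsDelsarteClique G k θ C) ∧
      ∀ u v, G.Adj u v → ∃! C : Finset V, C ∈ 𝒞 ∧ u ∈ C ∧ v ∈ C

/-- The motion of `G`: the minimum, over the non-identity automorphisms of `G`, of the number of
vertices that are not fixed. It is `⊤` if `G` has no non-identity automorphism. -/
noncomputable def motion {V : Type*} (G : SimpleGraph V) : ℕ∞ :=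
  ⨅ (σ : G ≃g G) (_ : σ ≠ RelIso.refl G.Adj), {v | σ v ≠ v}.encard

/-- `ε, η > 0` are spectral-gap constants for diameter `d`: every distance-regular graph of
diameter `d` has either an index `0 ≤ i ≤ d - 1` with `b i > ε k` and `c (i + 1) > ε k`, or
zero-weight spectral radius at most `k (1 - η)`. -/
def AreSpectralGapConstants (d : ℕ) (ε η : ℝ) : Prop :=
  0 < ε ∧ 0 < η ∧
    ∀ (V : Type u) [Fintype V] (G : SimpleGraph V) (a b c : ℕ → ℕ),
      IsDistanceRegular G d a b c →
        (∃ i < d, ε * (b 0 : ℝ) < b i ∧ ε * (b 0 : ℝ) < c (i + 1)) ∨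
          zeroWeightSpectralRadius G ≤ (b 0 : ℝ) * (1 - η)

/-! Existence of the constants. If `b` first drops at `j` and `c (j + 1)` were small as well, take
`w`, `u` at distance `j + 1` and a neighbour `v` of `u` at distance `j` from `w`. Few edges leave or
enter the ball of radius `j` about `w` at any vertex, so the spheres of radius at most `j` about `v`
stay mostly inside it and those about `u` mostly outside. The sphere intersections for the adjacent
pair `u`, `v` are then small; as they measure `a j` and `c j`, the identity `a j + b j + c j = k`
fails (`lt_c_succ_of_b_le`). Hence `b` is of order `k` before some index `t` and `c` is of order `k`
after it. If alternative (1) fails, `c` is tiny up to `t` and `b` is tiny from `t` on, so one sphere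
contains almost all vertices. An eigenfunction of sum zero then has tiny mean on that sphere, and
the three-term recurrence for its sphere means, followed inwards, contradicts its size at the centre
unless there is a spectral gap (`abs_eigenvalue_le_of_gap`).

Motion bound. The Delsarte cliques are lines: `m` through each vertex, more than `m` vertices on
each. Since `μ = 1`, automorphisms permute the lines, and the fixed lines that meet a moved line all
meet it in one vertex (`eq_of_mem_fixed`). So almost all lines meeting a moved line are moved, and
the set of moved lines barely expands. The spectral gap, through Cauchy–Schwarz and the identity `N
Nᵀ = m I + A` for the vertex–line incidence matrix, forces such a set to be a positive proportion of
all lines. A moved line has at most one fixed vertex, so a positive proportion of the vertices moves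
(`mul_card_le_card_moved`). -/

/-! ### Intersection numbers and intersections of spheres -/

namespace IsDistanceRegular
open Classical Finset

variable {V : Type*} [Fintype V] {G : SimpleGraph V} {d : ℕ} {a b c : ℕ → ℕ}

/-- The number of neighbours at distance `i` from a base point, of a vertex at distance `j` from
it. -/
def step (a b c : ℕ → ℕ) (j i : ℕ) : ℕ :=
  (if i = j then a j else 0) + (if i = j + 1 then b j else 0) + (if i + 1 = j then c j else 0)

/-- Distances from `v` to adjacent vertices differ by at most one, so `a`, `b`, `c` account for all
neighbours. Packing them into `step` avoids index cases in later double counts. -/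
theorem card_adj_dist (h : IsDistanceRegular G d a b c) (v y : V) (i : ℕ) :
    #{x | G.Adj y x ∧ G.dist v x = i} = step a b c (G.dist v y) i := by
  have ha := h.card_a v y
  have hb := h.card_b v y
  have hc := h.card_c v y
  rw [Set.ncard_eq_toFinset_card', Set.toFinset_ofPred] at ha hb hc
  unfold step
  by_cases h1 : i = G.dist v y
  · subst h1
    simpa using ha
  by_cases h2 : i = G.dist v y + 1
  · subst h2
    simpa [show ¬ (G.dist v y + 1 + 1 = G.dist v y) by omega] using hb
  by_cases h3 : i + 1 = G.dist v y
  · simp only [h1, h2, h3, if_true, if_false, zero_add]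
    rw [← hc]
    congr 1
    ext x
    simp only [mem_filter, mem_univ, true_and]
    constructor <;> rintro ⟨h4, h5⟩ <;> exact ⟨h4, by omega⟩
  · simp only [h1, h2, h3, if_false]
    rw [card_eq_zero, filter_eq_empty_iff]
    rintro x - ⟨h4, h5⟩
    have := h4.diff_dist_adj (u := v)
    omega

theorem degree_eq (h : IsDistanceRegular G d a b c) (y : V) : #{x | G.Adj y x} = b 0 := by
  have hb := h.card_b y y
  rw [Set.ncard_eq_toFinset_card', Set.toFinset_ofPred] at hb
  simp only [SimpleGraph.dist_self, zero_add, SimpleGraph.dist_eq_one_iff_adj, and_self] at hb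
  exact hb

theorem sum_eq_dist (h : IsDistanceRegular G d a b c) (v w : V) :
    a (G.dist v w) + b (G.dist v w) + c (G.dist v w) = b 0 := by
  have ha := h.card_a v w
  have hb := h.card_b v w
  have hc := h.card_c v w
  rw [Set.ncard_eq_toFinset_card', Set.toFinset_ofPred] at ha hb hc
  rw [← ha, ← hb, ← hc, ← h.degree_eq w, ← card_union_of_disjoint, ← card_union_of_disjoint]
  · congr 1
    ext x
    simp only [mem_union, mem_filter, mem_univ, true_and]
    constructor
    · tauto
    · intro h4
      have := h4.diff_dist_adj (u := v)
      have h5 : G.dist v x = G.dist v w ∨ G.dist v x = G.dist v w + 1 ∨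
        G.dist v x + 1 = G.dist v w := by omega
      tauto
  · rw [disjoint_left]
    intro x
    simp only [mem_union, mem_filter, mem_univ, true_and]
    omega
  · rw [disjoint_left]
    intro x
    simp only [mem_filter, mem_univ, true_and]
    omega

theorem dist_le (h : IsDistanceRegular G d a b c) (v w : V) : G.dist v w ≤ d := by
  have := h.connected.nonempty
  rw [← h.diam_eq]
  exact SimpleGraph.dist_le_diam (SimpleGraph.connected_iff_ediam_ne_top.1 h.connected)

omit [Fintype V] in
theorem exists_adj_dist (h : IsDistanceRegular G d a b c) {v w : V} {i : ℕ}
    (hi : G.dist v w = i + 1) : ∃ x, G.Adj w x ∧ G.dist v x = i := by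
  obtain ⟨p, hp⟩ := h.connected.exists_walk_length_eq_dist w v
  rw [SimpleGraph.dist_comm, hi] at hp
  cases p with
  | nil => simp at hp
  | @cons _ x _ hx p =>
    refine ⟨x, hx, ?_⟩
    have h1 := SimpleGraph.dist_le p
    have h2 := hx.diff_dist_adj (u := v)
    rw [SimpleGraph.dist_comm] at h1
    simp at hp
    omega

omit [Fintype V] in
theorem exists_dist_eq (h : IsDistanceRegular G d a b c) {i : ℕ} (hi : i ≤ d) :
    ∃ v w, G.dist v w = i := by
  have := h.connected.nonempty
  induction hi using Nat.decreasingInduction with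
  | self => rw [← h.diam_eq]; exact SimpleGraph.exists_dist_eq_diam
  | of_succ k _ ih =>
    obtain ⟨v, w, hvw⟩ := ih
    obtain ⟨x, -, hx⟩ := h.exists_adj_dist hvw
    exact ⟨v, x, hx⟩

theorem sum_eq (h : IsDistanceRegular G d a b c) {i : ℕ} (hi : i ≤ d) :
    a i + b i + c i = b 0 := by
  obtain ⟨v, w, rfl⟩ := h.exists_dist_eq hi
  exact h.sum_eq_dist v w

theorem c_pos (h : IsDistanceRegular G d a b c) {i : ℕ} (hi : i + 1 ≤ d) : 0 < c (i + 1) := by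
  obtain ⟨v, w, hvw⟩ := h.exists_dist_eq hi
  obtain ⟨x, hx, hd⟩ := h.exists_adj_dist hvw
  rw [← hvw, ← h.card_c v w, Set.ncard_pos]
  exact ⟨x, hx, by omega⟩

theorem b_pos (h : IsDistanceRegular G d a b c) {i : ℕ} (hi : i < d) : 0 < b i := by
  obtain ⟨v, w, hvw⟩ := h.exists_dist_eq (Nat.succ_le_of_lt hi)
  obtain ⟨x, hx, hd⟩ := h.exists_adj_dist hvw
  rw [← hd, ← h.card_b v x, Set.ncard_pos]
  exact ⟨w, hx.symm, by omega⟩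

theorem b_diam (h : IsDistanceRegular G d a b c) : b d = 0 := by
  obtain ⟨v, w, hvw⟩ := h.exists_dist_eq le_rfl
  have := h.card_b v w
  rw [hvw] at this
  rw [← this, Set.ncard_eq_zero]
  ext x
  simp only [Set.mem_ofPred_eq, Set.mem_empty_iff_false, iff_false, not_and]
  intro _
  have := h.dist_le v x
  omega

theorem a_zero (h : IsDistanceRegular G d a b c) : a 0 = 0 := by
  have := h.sum_eq (Nat.zero_le d)
  omega

/-- Let `v'` be a neighbour of `v` one step closer to `w`. A neighbour of `w` closer to `v'` is also
closer to `v`. The mirror inclusion gives `b_succ_le`. -/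
theorem c_le_succ (h : IsDistanceRegular G d a b c) {i : ℕ} (hi : i + 1 ≤ d) :
    c i ≤ c (i + 1) := by
  obtain ⟨w, v, hwv⟩ := h.exists_dist_eq hi
  obtain ⟨v', hv', hd⟩ := h.exists_adj_dist hwv
  rw [SimpleGraph.dist_comm] at hwv hd
  rw [← hwv, ← h.card_c v w, ← hd, ← h.card_c v' w]
  refine Set.ncard_le_ncard ?_
  rintro x ⟨hx, hdx⟩
  have h1 := hv'.diff_dist_adj (u := x)
  have h2 := hx.diff_dist_adj (u := v)
  rw [SimpleGraph.dist_comm (u := x), SimpleGraph.dist_comm (u := x)] at h1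
  exact ⟨hx, by omega⟩

theorem b_succ_le (h : IsDistanceRegular G d a b c) {i : ℕ} (hi : i + 1 ≤ d) :
    b (i + 1) ≤ b i := by
  obtain ⟨w, v, hwv⟩ := h.exists_dist_eq hi
  obtain ⟨v', hv', hd⟩ := h.exists_adj_dist hwv
  rw [SimpleGraph.dist_comm] at hwv hd
  rw [← hwv, ← h.card_b v w, ← hd, ← h.card_b v' w]
  refine Set.ncard_le_ncard ?_
  rintro x ⟨hx, hdx⟩
  have h1 := hv'.diff_dist_adj (u := x)
  have h2 := hx.diff_dist_adj (u := v')
  rw [SimpleGraph.dist_comm (u := x), SimpleGraph.dist_comm (u := x)] at h1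
  exact ⟨hx, by omega⟩

theorem c_mono (h : IsDistanceRegular G d a b c) {i j : ℕ} (hij : i ≤ j) (hj : j ≤ d) :
    c i ≤ c j := by
  induction j, hij using Nat.le_induction with
  | base => exact le_rfl
  | succ j _ ih => exact (ih (by omega)).trans (h.c_le_succ hj)

theorem b_anti (h : IsDistanceRegular G d a b c) {i j : ℕ} (hij : i ≤ j) (hj : j ≤ d) :
    b j ≤ b i := by
  induction j, hij using Nat.le_induction with
  | base => exact le_rfl
  | succ j _ ih => exact (h.b_succ_le hj).trans (ih (by omega))

/-- Summing a function over the neighbourhoods of all vertices of a sphere. -/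
theorem sum_sphere_sum_adj (h : IsDistanceRegular G d a b c) {R : Type*} [Semiring R]
    (v : V) (i : ℕ) (F : V → R) :
    ∑ x with G.dist v x = i, ∑ y with G.Adj x y, F y =
      ∑ y, (step a b c (G.dist v y) i : R) * F y := by
  simp_rw [sum_filter]
  have : ∀ x, (if G.dist v x = i then ∑ y, if G.Adj x y then F y else 0 else 0) =
      ∑ y, if G.Adj y x ∧ G.dist v x = i then F y else 0 := by
    intro x
    split_ifs with hx
    · simp [hx, SimpleGraph.adj_comm]
    · simp [hx]
  rw [sum_congr rfl fun x _ => this x, sum_comm]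
  refine sum_congr rfl fun y _ => ?_
  rw [← sum_filter, sum_const, h.card_adj_dist, nsmul_eq_mul]

/-- The three-term expansion of a sum weighted by intersection numbers. -/
theorem sum_step_mul {R : Type*} [Semiring R]
    (v : V) (i : ℕ) (F : V → R) :
    ∑ y, (step a b c (G.dist v y) (i + 1) : R) * F y =
      a (i + 1) * ∑ y with G.dist v y = i + 1, F y + b i * ∑ y with G.dist v y = i, F y +
      c (i + 2) * ∑ y with G.dist v y = i + 2, F y := by
  simp_rw [mul_sum, sum_filter, ← sum_add_distrib]
  refine sum_congr rfl fun y _ => ?_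
  unfold step
  by_cases h1 : G.dist v y = i + 1
  · simp [h1]
  by_cases h2 : G.dist v y = i
  · simp [h2, show i + 1 + 1 ≠ i by omega]
  by_cases h3 : G.dist v y = i + 2
  · simp [h3]
  · simp [h1, h2, h3, Ne.symm h1, Ne.symm h2, Ne.symm h3]

theorem sum_step_zero_mul (h : IsDistanceRegular G d a b c) {R : Type*} [Semiring R]
    (v : V) (F : V → R) :
    ∑ y, (step a b c (G.dist v y) 0 : R) * F y = c 1 * ∑ y with G.dist v y = 1, F y := by
  simp_rw [mul_sum, sum_filter]
  refine sum_congr rfl fun y _ => ?_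
  unfold step
  by_cases h1 : G.dist v y = 1
  · simp [h1]
  by_cases h2 : G.dist v y = 0
  · simp [h2, h.a_zero]
  · simp [h1, Ne.symm h1, Ne.symm h2]

/-- The number of vertices at distance `i` from `u` and at distance `s` from `v`. -/
noncomputable def inter (G : SimpleGraph V) (i s : ℕ) (u v : V) : ℕ := #{x | G.dist u x = i ∧ G.dist v x = s}

/-- Double counting of pairs `(w, x)` with `w` adjacent to `u`; this is the recursion that
determines the sphere intersections. -/
theorem sum_adj_inter (h : IsDistanceRegular G d a b c) (i s : ℕ) (u v : V) :
    ∑ w with G.Adj u w, inter G i s w v =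
      ∑ x with G.dist v x = s, step a b c (G.dist x u) i := by
  unfold inter
  simp_rw [card_eq_sum_ones, sum_filter]
  have : ∀ w, (if G.Adj u w then ∑ x, (if G.dist w x = i ∧ G.dist v x = s then 1 else 0) else 0) =
      ∑ x, if G.dist v x = s then (if G.Adj u w ∧ G.dist x w = i then 1 else 0) else 0 := by
    intro w
    split_ifs with hw
    · refine sum_congr rfl fun x _ => ?_
      rw [SimpleGraph.dist_comm (u := w)]
      simp only [hw, true_and]
      by_cases h1 : G.dist v x = s <;> simp [h1]
    · simp [hw]
  rw [sum_congr rfl fun w _ => this w, sum_comm]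
  refine sum_congr rfl fun x _ => ?_
  split_ifs with hx
  · rw [← sum_filter, ← card_eq_sum_ones, h.card_adj_dist]
  · simp

/-- The intersection sizes of spheres depend only on the distance of their centres. -/
theorem exists_inter_eq (h : IsDistanceRegular G d a b c) (i : ℕ) :
    ∃ P : ℕ → ℕ → ℕ, ∀ s u v, inter G i s u v = P s (G.dist u v) := by
  induction i using Nat.strong_induction_on with
  | _ i ih =>
    have key : ∀ s u v u' v', G.dist u v = G.dist u' v' → inter G i s u v = inter G i s u' v' := by
      intro s u v u' v' huv
      by_cases hid : d < i
      · have : ∀ u v, inter G i s u v = 0 := by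
          intro u v
          unfold inter
          rw [card_eq_zero, filter_eq_empty_iff]
          rintro x - ⟨h1, -⟩
          have := h.dist_le u x
          omega
        rw [this, this]
      rcases i with _ | i
      · have : ∀ u v, inter G 0 s u v = if G.dist u v = s then 1 else 0 := by
          intro u v
          unfold inter
          simp_rw [h.connected.dist_eq_zero_iff]
          rw [SimpleGraph.dist_comm]
          split_ifs with h1
          · rw [card_eq_one]
            refine ⟨u, ?_⟩
            ext x
            simp only [mem_filter, mem_univ, true_and, mem_singleton]
            constructor
            · exact fun h => h.1.symm
            · rintro rfl
              exact ⟨rfl, h1⟩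
          · rw [card_eq_zero, filter_eq_empty_iff]
            rintro x - ⟨rfl, h2⟩
            exact h1 h2
        rw [this, this, huv]
      -- The neighbours of `u`, sorted by distance from `v`, occur with multiplicities `step`, and
      -- by induction each contributes a number depending only on that distance.
      have hw : ∀ u v u' v', G.dist u v = G.dist u' v' →
          ∑ w with G.Adj u w, inter G i s w v = ∑ w with G.Adj u' w, inter G i s w v' := by
        obtain ⟨P, hP⟩ := ih i (by omega)
        have : ∀ u v, ∑ w with G.Adj u w, inter G i s w v =
            ∑ j ∈ range (d + 1), step a b c (G.dist u v) j * P s j := by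
          intro u v
          simp_rw [hP]
          rw [← sum_fiberwise_of_maps_to (t := range (d + 1)) (g := fun w => G.dist v w)]
          · refine sum_congr rfl fun j _ => ?_
            rw [filter_filter, SimpleGraph.dist_comm, ← h.card_adj_dist v u j, ← smul_eq_mul,
              ← sum_const]
            refine sum_congr rfl fun w hw => ?_
            rw [SimpleGraph.dist_comm, (mem_filter.1 hw).2.2]
          · intro w _
            rw [mem_range]
            have := h.dist_le v w
            omega
        intro u v u' v' huv
        rw [this, this, huv]
      have hx : ∀ (i : ℕ) u v, ∑ x with G.dist v x = s, (if G.dist u x = i then 1 else 0) =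
          inter G i s u v := by
        intro i u v
        unfold inter
        rw [card_eq_sum_ones, ← sum_filter, filter_filter]
        simp_rw [and_comm]
      have expand : ∀ u v, ∑ w with G.Adj u w, inter G i s w v =
          c (i + 1) * inter G (i + 1) s u v + a i * inter G i s u v +
          (if i = 0 then 0 else b (i - 1) * inter G (i - 1) s u v) := by
        intro u v
        rw [h.sum_adj_inter]
        rw [← hx, ← hx, ← hx, mul_sum, mul_sum]
        by_cases hi : i = 0
        · subst hi
          simp only [if_true, add_zero, ← sum_add_distrib]
          refine sum_congr rfl fun x _ => ?_
          rw [SimpleGraph.dist_comm]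
          unfold step
          have h1 := h.a_zero
          by_cases h2 : G.dist u x = 0
          · simp [h2, h1]
          by_cases h3 : G.dist u x = 1
          · simp [h3]
          · simp [h2, h3, Ne.symm h2, Ne.symm h3]
        · simp only [hi, if_false, mul_sum, ← sum_add_distrib]
          refine sum_congr rfl fun x _ => ?_
          rw [SimpleGraph.dist_comm]
          obtain ⟨i, rfl⟩ := Nat.exists_eq_succ_of_ne_zero hi
          unfold step
          by_cases h1 : G.dist u x = i + 1
          · simp [h1]
          by_cases h2 : G.dist u x = i
          · simp [h2, show i + 1 + 1 ≠ i by omega, show i ≠ i + 1 + 1 by omega]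
          by_cases h3 : G.dist u x = i + 2
          · simp [h3]
          · simp [h1, h2, h3, Ne.symm h1, Ne.symm h2]
            omega
      have e1 := expand u v
      have e2 := expand u' v'
      rw [hw u v u' v' huv] at e1
      obtain ⟨P, hP⟩ := ih i (by omega)
      have e3 : inter G i s u v = inter G i s u' v' := by rw [hP, hP, huv]
      have e4 : inter G (i - 1) s u v = inter G (i - 1) s u' v' := by
        obtain ⟨P, hP⟩ := ih (i - 1) (by omega)
        rw [hP, hP, huv]
      rw [e3, e4] at e1
      -- In the expansion every term but the one of radius `i + 1` is already known, and its
      -- coefficient `c (i + 1)` is positive.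
      have e5 : c (i + 1) * inter G (i + 1) s u v = c (i + 1) * inter G (i + 1) s u' v' := by omega
      exact Nat.eq_of_mul_eq_mul_left (h.c_pos (by omega)) e5
    -- `P s j` is read off from any pair at distance `j`; the value 0 at unrealised distances is
    -- never used.
    refine ⟨fun s j => if hj : ∃ p : V × V, G.dist p.1 p.2 = j then
      inter G i s hj.choose.1 hj.choose.2 else 0, fun s u v => ?_⟩
    have hj : ∃ p : V × V, G.dist p.1 p.2 = G.dist u v := ⟨(u, v), rfl⟩
    simp only [dif_pos hj]
    exact key s _ _ _ _ hj.choose_spec.symm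

/-- The size of the sphere of radius `i` about `v`. -/
noncomputable def sphereCard (G : SimpleGraph V) (v : V) (i : ℕ) : ℕ := #{x | G.dist v x = i}

theorem sphereCard_eq (h : IsDistanceRegular G d a b c) (u v : V) (i : ℕ) :
    sphereCard G u i = sphereCard G v i := by
  obtain ⟨P, hP⟩ := h.exists_inter_eq i
  have h1 := hP i u u
  have h2 := hP i v v
  rw [SimpleGraph.dist_self] at h1 h2
  unfold inter at h1 h2
  simp only [and_self] at h1 h2
  unfold sphereCard
  rw [h1, h2]

theorem sphereCard_mul (h : IsDistanceRegular G d a b c) (v : V) (i : ℕ) :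
    sphereCard G v i * b i = sphereCard G v (i + 1) * c (i + 1) := by
  have := sum_card_bipartiteAbove_eq_sum_card_bipartiteBelow (s := {x | G.dist v x = i})
    (t := {x | G.dist v x = i + 1}) (r := fun x y => G.Adj x y)
  unfold bipartiteAbove bipartiteBelow at this
  simp only [filter_filter] at this
  unfold sphereCard
  rw [← smul_eq_mul, ← sum_const, ← smul_eq_mul, ← sum_const]
  convert this using 1
  · refine sum_congr rfl fun x hx => ?_
    have hx := (mem_filter.1 hx).2
    have e := h.card_adj_dist v x (i + 1)
    rw [hx] at e
    trans #{y | G.Adj x y ∧ G.dist v y = i + 1}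
    · rw [e]
      simp [step]
      omega
    · congr 1
      ext y
      simp only [mem_filter, mem_univ, true_and]
      tauto
  · refine sum_congr rfl fun x hx => ?_
    have hx := (mem_filter.1 hx).2
    have e := h.card_adj_dist v x i
    rw [hx] at e
    trans #{y | G.Adj x y ∧ G.dist v y = i}
    · rw [e]
      simp [step]
      omega
    · congr 1
      ext y
      simp only [mem_filter, mem_univ, true_and, G.adj_comm x]
      tauto

theorem sphereCard_zero (h : IsDistanceRegular G d a b c) (v : V) : sphereCard G v 0 = 1 := by
  unfold sphereCard
  rw [card_eq_one]
  refine ⟨v, ?_⟩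
  ext x
  simp [h.connected.dist_eq_zero_iff, eq_comm]

theorem sphereCard_pos (h : IsDistanceRegular G d a b c) (v : V) {i : ℕ} (hi : i ≤ d) :
    0 < sphereCard G v i := by
  induction i with
  | zero => rw [h.sphereCard_zero]; exact one_pos
  | succ i ih =>
    refine Nat.pos_of_mul_pos_right (b := c (i + 1)) ?_
    rw [← h.sphereCard_mul]
    exact Nat.mul_pos (ih (by omega)) (h.b_pos (by omega))

/-- For adjacent `u`, `v`, the sphere intersection sizes are given by the intersection numbers. -/
theorem mul_inter_of_adj (h : IsDistanceRegular G d a b c) {u v : V} (huv : G.Adj u v) (i s : ℕ) :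
    b 0 * inter G i s u v = sphereCard G v s * step a b c s i := by
  obtain ⟨P, hP⟩ := h.exists_inter_eq i
  -- With both centres at `v`, all neighbours `w` of `v` contribute the same number, the one for
  -- adjacent centres.
  have h1 := h.sum_adj_inter i s v v
  rw [hP, SimpleGraph.dist_eq_one_iff_adj.2 huv, ← h.degree_eq v, ← smul_eq_mul, ← sum_const]
  unfold sphereCard
  rw [← smul_eq_mul, ← sum_const]
  convert h1 using 1
  · refine sum_congr rfl fun w hw => ?_
    rw [hP, SimpleGraph.dist_comm, SimpleGraph.dist_eq_one_iff_adj.2 (mem_filter.1 hw).2]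
  · refine sum_congr rfl fun x hx => ?_
    rw [SimpleGraph.dist_comm, (mem_filter.1 hx).2]

end IsDistanceRegular

/-! ### A drop in `b` forces growth in `c` -/

namespace IsDistanceRegular
open Classical Finset

variable {V : Type*} [Fintype V] {G : SimpleGraph V} {d : ℕ} {a b c : ℕ → ℕ}

theorem degree_pos (h : IsDistanceRegular G d a b c) (hd : 0 < d) : (0 : ℝ) < b 0 := by
  exact_mod_cast h.b_pos hd

/-- If few edges lead into `W` from each vertex outside `W`, then small spheres about a vertex
outside `W` contain few vertices of `W`. -/
theorem card_sphere_inter_le (h : IsDistanceRegular G d a b c) {D δ : ℝ} (hδ : 0 ≤ δ)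
    (W : V → Prop) (hW : ∀ x, ¬ W x → (#{y | G.Adj x y ∧ W y} : ℝ) ≤ δ * b 0)
    {v : V} (hv : ¬ W v) {s : ℕ} (hs : s ≤ d) (hb : ∀ i < s, D * b 0 ≤ b i) :
    D * #{x | G.dist v x = s ∧ W x} ≤ s * δ * sphereCard G v s := by
  induction s with
  | zero =>
    have : #{x | G.dist v x = 0 ∧ W x} = 0 := by
      rw [card_eq_zero, filter_eq_empty_iff]
      rintro x - ⟨h1, h2⟩
      rw [h.connected.dist_eq_zero_iff] at h1
      subst h1
      exact hv h2
    rw [this]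
    simp
  | succ s ih =>
    have ih := ih (by omega) fun i hi => hb i (by omega)
    have hbs := hb s (by omega)
    have hk := h.degree_pos (by omega)
    have hc : (0 : ℝ) < c (s + 1) := by exact_mod_cast h.c_pos hs
    have hK : (sphereCard G v s * b s : ℝ) = sphereCard G v (s + 1) * c (s + 1) := by
      exact_mod_cast h.sphereCard_mul v s
    have hKpos : (0 : ℝ) ≤ sphereCard G v s := by positivity
    -- Edges from the sphere of radius `s` into the part of the next sphere in `W`: each endpoint in
    -- `W` receives `c (s + 1)`, while a vertex of the inner sphere sends at most `b s`, and at most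
    -- `δ * b 0` if it is outside `W`.
    have count := sum_card_bipartiteAbove_eq_sum_card_bipartiteBelow (s := {x | G.dist v x = s})
      (t := {x | G.dist v x = s + 1 ∧ W x}) (r := fun x y => G.Adj x y)
    unfold bipartiteAbove bipartiteBelow at count
    simp only [filter_filter] at count
    have hr : ∑ y with G.dist v y = s + 1 ∧ W y, #{x | G.dist v x = s ∧ G.Adj x y} =
        #{x | G.dist v x = s + 1 ∧ W x} * c (s + 1) := by
      rw [← smul_eq_mul, ← sum_const]
      refine sum_congr rfl fun y hy => ?_
      have hy := (mem_filter.1 hy).2.1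
      have e := h.card_adj_dist v y s
      rw [hy] at e
      trans #{x | G.Adj y x ∧ G.dist v x = s}
      · congr 1
        ext x
        simp only [mem_filter, mem_univ, true_and, G.adj_comm x]
        tauto
      · rw [e]
        simp [step]
        omega
    rw [hr] at count
    have hl : (∑ x with G.dist v x = s, (#{y | (G.dist v y = s + 1 ∧ W y) ∧ G.Adj x y} : ℝ)) ≤
        #{x | G.dist v x = s ∧ W x} * b s + sphereCard G v s * (δ * b 0) := by
      have h1 : ∀ x ∈ ({x | G.dist v x = s} : Finset V),
          (#{y | (G.dist v y = s + 1 ∧ W y) ∧ G.Adj x y} : ℝ) ≤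
            (if W x then (b s : ℝ) else 0) + δ * b 0 := by
        intro x hx
        have hx := (mem_filter.1 hx).2
        by_cases hWx : W x
        · rw [if_pos hWx]
          have e := h.card_adj_dist v x (s + 1)
          rw [hx, show step a b c s (s + 1) = b s by simp [step]; omega] at e
          have : #{y | (G.dist v y = s + 1 ∧ W y) ∧ G.Adj x y} ≤ b s := by
            rw [← e]
            refine card_le_card fun y => ?_
            simp only [mem_filter, mem_univ, true_and]
            tauto
          have : (#{y | (G.dist v y = s + 1 ∧ W y) ∧ G.Adj x y} : ℝ) ≤ b s := by
            exact_mod_cast this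
          nlinarith
        · rw [if_neg hWx, zero_add]
          refine le_trans ?_ (hW x hWx)
          norm_cast
          refine card_le_card fun y => ?_
          simp only [mem_filter, mem_univ, true_and]
          tauto
      refine (sum_le_sum h1).trans_eq ?_
      rw [sum_add_distrib, sum_const, ← sum_filter, sum_const, filter_filter, nsmul_eq_mul,
        nsmul_eq_mul]
      rfl
    have count' : (∑ x with G.dist v x = s, (#{y | (G.dist v y = s + 1 ∧ W y) ∧ G.Adj x y} : ℝ)) =
        #{x | G.dist v x = s + 1 ∧ W x} * c (s + 1) := by
      exact_mod_cast count
    rw [count'] at hl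
    have hD : 0 ≤ D ∨ D < 0 := le_or_gt 0 D
    rcases hD with hD | hD
    · push_cast
      refine le_of_mul_le_mul_right ?_ hc
      have e1 := mul_le_mul_of_nonneg_left hl hD
      have e2 := mul_le_mul_of_nonneg_right ih (Nat.cast_nonneg (α := ℝ) (b s))
      have e3 : (sphereCard G v s : ℝ) * δ * (D * b 0) ≤ sphereCard G v s * δ * b s :=
        mul_le_mul_of_nonneg_left hbs (by positivity)
      have e4 : ((s : ℝ) + 1) * δ * sphereCard G v (s + 1) * c (s + 1) =
          (s + 1) * δ * (sphereCard G v s * b s) := by rw [hK]; ring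
      rw [e4]
      linarith
    · refine le_trans ?_ (by positivity : (0 : ℝ) ≤ _)
      have : (0 : ℝ) ≤ #{x | G.dist v x = s + 1 ∧ W x} := by positivity
      nlinarith

/-- After a drop of the sequence `b`, the next term of the sequence `c` is large. -/
theorem lt_c_succ_of_b_le (h : IsDistanceRegular G d a b c) {D δ : ℝ} (hD : 0 < D)
    (hD2 : D ≤ 1 / 2) (hδ : δ = D ^ 2 / (16 * d)) {j : ℕ} (hj1 : 1 ≤ j) (hjd : j < d)
    (hb : ∀ i < j, D * b 0 ≤ b i) (hbj : (b j : ℝ) ≤ δ * b 0) : δ * b 0 < c (j + 1) := by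
  by_contra! hcj
  have hk := h.degree_pos (by omega)
  have hdR : (1 : ℝ) ≤ d := by exact_mod_cast (by omega : 1 ≤ d)
  have hδd : δ * d = D ^ 2 / 16 := by rw [hδ]; field_simp
  have hδ0 : 0 < δ := by rw [hδ]; positivity
  obtain ⟨w, u, hwu⟩ := h.exists_dist_eq (Nat.succ_le_of_lt hjd)
  obtain ⟨v, huv, hwv⟩ := h.exists_adj_dist hwu
  -- `W'` is the ball of radius `j` about `w` and `W` its complement; `v` lies outside `W` and `u`
  -- outside `W'`.
  obtain ⟨W, hW⟩ : ∃ W : V → Prop, ∀ x, W x ↔ j < G.dist w x := ⟨_, fun _ => Iff.rfl⟩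
  obtain ⟨W', hW'⟩ : ∃ W : V → Prop, ∀ x, W x ↔ G.dist w x ≤ j := ⟨_, fun _ => Iff.rfl⟩
  have out : ∀ s ≤ j, D * #{x | G.dist v x = s ∧ W x} ≤ d * δ * sphereCard G v s := by
    intro s hs
    refine (h.card_sphere_inter_le hδ0.le W ?_ (by rw [hW]; omega) (by omega)
      fun i hi => hb i (by omega)).trans ?_
    · intro x hx
      refine le_trans ?_ hbj
      rw [hW] at hx
      have e := h.card_adj_dist w x (j + 1)
      have e2 : step a b c (G.dist w x) (j + 1) ≤ b j := by
        unfold step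
        rw [if_neg (by omega), if_neg (by omega : ¬ (j + 1 + 1 = G.dist w x))]
        split_ifs with h1
        · rw [show G.dist w x = j by omega]
          omega
        · omega
      rw [← e] at e2
      refine le_trans ?_ (Nat.cast_le.2 e2)
      norm_cast
      refine card_le_card fun y => ?_
      simp only [mem_filter, mem_univ, true_and, hW]
      rintro ⟨h1, h2⟩
      have := h1.diff_dist_adj (u := w)
      exact ⟨h1, by omega⟩
    · gcongr
      omega
  have ins : ∀ s ≤ j, D * #{x | G.dist u x = s ∧ W' x} ≤
      d * δ * sphereCard G u s := by
    intro s hs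
    refine (h.card_sphere_inter_le hδ0.le W' ?_ (by rw [hW']; omega) (by omega)
      fun i hi => hb i (by omega)).trans ?_
    · intro x hx
      refine le_trans ?_ hcj
      rw [hW'] at hx
      have e := h.card_adj_dist w x j
      have e2 : step a b c (G.dist w x) j ≤ c (j + 1) := by
        unfold step
        rw [if_neg (by omega), if_neg (by omega : ¬ (j = G.dist w x + 1))]
        split_ifs with h1
        · rw [← h1]
          omega
        · omega
      rw [← e] at e2
      refine le_trans ?_ (Nat.cast_le.2 e2)
      norm_cast
      refine card_le_card fun y => ?_
      simp only [mem_filter, mem_univ, true_and, hW']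
      rintro ⟨h1, h2⟩
      have := h1.diff_dist_adj (u := w)
      exact ⟨h1, by omega⟩
    · gcongr
      omega
  have both : ∀ s ≤ j, D * (b 0 * inter G j s u v : ℝ) ≤
      b 0 * (D ^ 2 / 16 * (sphereCard G v s + sphereCard G v j)) := by
    intro s hs
    -- Every vertex is in `W`, exceptional for spheres about `v`, or in `W'`, exceptional for
    -- spheres about `u`.
    have h1 : inter G j s u v ≤ #{x | G.dist v x = s ∧ W x} +
        #{x | G.dist u x = j ∧ W' x} := by
      refine (card_le_card ?_).trans (card_union_le _ _)
      intro x
      simp only [mem_filter, mem_univ, true_and, mem_union, hW, hW']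
      have := lt_or_ge j (G.dist w x)
      tauto
    have h1 : (inter G j s u v : ℝ) ≤ #{x | G.dist v x = s ∧ W x} +
        #{x | G.dist u x = j ∧ W' x} := by exact_mod_cast h1
    have h2 := out s hs
    have h3 := ins j le_rfl
    rw [h.sphereCard_eq u v] at h3
    have h4 := mul_le_mul_of_nonneg_left h1 hD.le
    have h5 : D * (inter G j s u v : ℝ) ≤
        D ^ 2 / 16 * (sphereCard G v s + sphereCard G v j) := by
      rw [← hδd]
      linarith
    have := mul_le_mul_of_nonneg_left h5 hk.le
    linarith
  -- For adjacent centres the intersection with `s = j` measures `a j`, and with `s = j - 1` it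
  -- measures `c j`. Both turn out small, and `b j` is small by hypothesis, so they cannot add up to
  -- `b 0`.
  have m1 : (b 0 * inter G j j u v : ℝ) = sphereCard G v j * a j := by
    have := h.mul_inter_of_adj huv.symm.symm j j
    rw [show step a b c j j = a j by simp [step]] at this
    exact_mod_cast this
  have m2 : (b 0 * inter G j (j - 1) u v : ℝ) = sphereCard G v (j - 1) * b (j - 1) := by
    have := h.mul_inter_of_adj huv.symm.symm j (j - 1)
    rw [show step a b c (j - 1) j = b (j - 1) by
      simp [step, show j - 1 + 1 = j by omega, show j ≠ j - 1 by omega]; omega] at this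
    exact_mod_cast this
  have hK : (sphereCard G v (j - 1) * b (j - 1) : ℝ) = sphereCard G v j * c j := by
    have := h.sphereCard_mul v (j - 1)
    rw [show j - 1 + 1 = j by omega] at this
    exact_mod_cast this
  have hKj : (0 : ℝ) < sphereCard G v j := by exact_mod_cast h.sphereCard_pos v hjd.le
  have b1 := both j le_rfl
  have b2 := both (j - 1) (by omega)
  rw [m1] at b1
  rw [m2, hK] at b2
  have ha : D * a j ≤ b 0 * (D ^ 2 / 8) := by
    refine le_of_mul_le_mul_left ?_ hKj
    linarith
  have ha : (a j : ℝ) ≤ b 0 * (1 / 16) := by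
    refine le_of_mul_le_mul_left (ha.trans ?_) hD
    have : D * D * b 0 ≤ D * (1 / 2) * b 0 := by gcongr
    linarith
  have hc : (D * (b 0 : ℝ)) * sphereCard G v (j - 1) ≤ sphereCard G v j * c j := by
    rw [← hK]
    have := hb (j - 1) (by omega)
    have := mul_le_mul_of_nonneg_left this (Nat.cast_nonneg (α := ℝ) (sphereCard G v (j - 1)))
    linarith
  have hc2 : (c j : ℝ) ≤ b 0 * (1 / 30) := by
    have e1 : D * c j ≤ D / 16 * c j + b 0 * (D ^ 2 / 16) := by
      refine le_of_mul_le_mul_left ?_ hKj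
      have : D / 16 * ((D * (b 0 : ℝ)) * sphereCard G v (j - 1)) ≤
        D / 16 * (sphereCard G v j * c j) := by gcongr
      linarith
    have e2 : D * (c j : ℝ) * (15 / 16) ≤ D * (b 0 * (1 / 32)) := by
      have : D * D * b 0 ≤ D * (1 / 2) * b 0 := by gcongr
      linarith
    have e3 : (c j : ℝ) * (15 / 16) ≤ b 0 * (1 / 32) := by
      refine le_of_mul_le_mul_left ?_ hD
      linarith
    linarith
  have hδ2 : δ ≤ 1 / 64 := by
    have : δ * 1 ≤ δ * d := by gcongr
    nlinarith
  have hb2 : (b j : ℝ) ≤ b 0 * (1 / 64) := by nlinarith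
  have hs : (a j + b j + c j : ℝ) = b 0 := by exact_mod_cast h.sum_eq hjd.le
  linarith

end IsDistanceRegular

/-! ### Eigenfunctions and the quadratic form of the adjacency matrix -/

namespace IsDistanceRegular
open Classical Finset

variable {V : Type*} [Fintype V] {G : SimpleGraph V} {d : ℕ} {a b c : ℕ → ℕ}

/-- An orthonormal family of eigenfunctions, ordered by the eigenvalues of the adjacency matrix. -/
theorem exists_eigenfunctions (G : SimpleGraph V) : ∃ e : Fin (Fintype.card V) → V → ℝ,
    (∀ i j, ∑ x, e i x * e j x = if i = j then 1 else 0) ∧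
    (∀ i v, ∑ y with G.Adj v y, e i y =
      (isHermitian_realAdjMatrix G).eigenvalues₀ i * e i v) ∧
    ∀ f g : V → ℝ, ∑ x, f x * g x = ∑ i, (∑ x, e i x * f x) * ∑ x, e i x * g x := by
  set hA := isHermitian_realAdjMatrix G
  -- This is the equivalence relating `eigenvalues` to `eigenvalues₀`; indexing through it keeps the
  -- decreasing order.
  set σ := Fintype.equivOfCardEq (Fintype.card_fin (Fintype.card V)) with hσ
  have inner_eq : ∀ f g : EuclideanSpace ℝ V, inner ℝ f g = ∑ x, f x * g x := by
    intro f g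
    simp [PiLp.inner_apply, mul_comm]
  refine ⟨fun i x => hA.eigenvectorBasis (σ i) x, ?_, ?_, ?_⟩
  · intro i j
    rw [← inner_eq, orthonormal_iff_ite.1 hA.eigenvectorBasis.orthonormal]
    simp
  · intro i v
    have h1 := congrFun (hA.mulVec_eigenvectorBasis (σ i)) v
    have h2 : hA.eigenvalues (σ i) = hA.eigenvalues₀ i := by
      unfold Matrix.IsHermitian.eigenvalues
      rw [← hσ, Equiv.symm_apply_apply]
    rw [h2] at h1
    simp only [Pi.smul_apply, smul_eq_mul] at h1
    have h3 : ∀ y, realAdjMatrix G v y = if G.Adj v y then 1 else 0 := fun y =>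
      SimpleGraph.adjMatrix_apply ..
    rw [← h1, Matrix.mulVec, dotProduct, sum_filter]
    refine sum_congr rfl fun y _ => ?_
    rw [h3]
    split_ifs <;> simp
  · intro f g
    have := hA.eigenvectorBasis.sum_inner_mul_inner (WithLp.toLp 2 f) (WithLp.toLp 2 g)
    rw [inner_eq] at this
    refine this.symm.trans ?_
    rw [← σ.sum_comp]
    refine sum_congr rfl fun i _ => ?_
    rw [inner_eq, inner_eq]
    simp [mul_comm]

theorem abs_eigenvalue_le (h : IsDistanceRegular G d a b c) {θ : ℝ} {f : V → ℝ}
    (hf : ∀ v, ∑ y with G.Adj v y, f y = θ * f v) {v : V} (hv : ∀ w, |f w| ≤ |f v|)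
    (h0 : f v ≠ 0) : |θ| ≤ b 0 := by
  refine le_of_mul_le_mul_right ?_ (abs_pos.2 h0)
  rw [← abs_mul, ← hf]
  refine (abs_sum_le_sum_abs _ _).trans ((sum_le_sum fun w _ => hv w).trans_eq ?_)
  rw [sum_const, h.degree_eq, nsmul_eq_mul]

/-- Maximum principle: at a maximum of `f` the mean over the neighbours equals the maximum, so the
value spreads to all neighbours and by connectedness everywhere. -/
theorem eq_of_eigenvalue_eq_degree (h : IsDistanceRegular G d a b c) {f : V → ℝ}
    (hf : ∀ v, ∑ y with G.Adj v y, f y = b 0 * f v) (v w : V) : f v = f w := by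
  obtain ⟨u, -, hu⟩ := exists_max_image (univ : Finset V) f ⟨v, mem_univ v⟩
  have key : ∀ n w, G.dist u w = n → f w = f u := by
    intro n
    induction n with
    | zero =>
      intro w hw
      rw [h.connected.dist_eq_zero_iff.1 hw]
    | succ n ih =>
      intro w hw
      obtain ⟨x, hx, hux⟩ := h.exists_adj_dist hw
      have h1 := ih x hux
      by_contra hne
      have : ∑ y with G.Adj x y, f y < ∑ y with G.Adj x y, f u :=
        sum_lt_sum (fun y _ => hu y (mem_univ y))
          ⟨w, by simpa using hx.symm, lt_of_le_of_ne (hu w (mem_univ w)) hne⟩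
      rw [hf, sum_const, h.degree_eq, nsmul_eq_mul, h1] at this
      exact lt_irrefl _ this
  rw [key _ v rfl, key _ w rfl]

theorem sum_sum_adj (h : IsDistanceRegular G d a b c) (f : V → ℝ) :
    ∑ v, ∑ y with G.Adj v y, f y = b 0 * ∑ v, f v := by
  simp_rw [sum_filter]
  rw [sum_comm, mul_sum]
  refine sum_congr rfl fun y _ => ?_
  rw [← sum_filter, sum_const, nsmul_eq_mul]
  simp_rw [G.adj_comm _ y]
  rw [h.degree_eq]

theorem sum_eq_zero_of_eigenvalue_ne (h : IsDistanceRegular G d a b c) {θ : ℝ} {f : V → ℝ}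
    (hf : ∀ v, ∑ y with G.Adj v y, f y = θ * f v) (hθ : θ ≠ b 0) : ∑ v, f v = 0 := by
  have := h.sum_sum_adj f
  simp_rw [hf, ← mul_sum] at this
  have h2 : (θ - b 0) * ∑ v, f v = 0 := by linarith
  exact (mul_eq_zero.1 h2).resolve_left (sub_ne_zero.2 hθ)

/-- The non-principal eigenvalues of a distance-regular graph belong to an orthonormal family of
eigenfunctions orthogonal to the constants. -/
theorem exists_eigenfunctions_sum_eq_zero (h : IsDistanceRegular G d a b c) :
    ∃ e : Fin (Fintype.card V) → V → ℝ,
    (∀ i j, ∑ x, e i x * e j x = if i = j then 1 else 0) ∧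
    (∀ i v, ∑ y with G.Adj v y, e i y =
      (isHermitian_realAdjMatrix G).eigenvalues₀ i * e i v) ∧
    (∀ f g : V → ℝ, ∑ x, f x * g x = ∑ i, (∑ x, e i x * f x) * ∑ x, e i x * g x) ∧
    ∀ i, 1 ≤ i.val → ∑ v, e i v = 0 := by
  obtain ⟨e, horth, heig, hpars⟩ := exists_eigenfunctions G
  refine ⟨e, horth, heig, hpars, fun i hi => ?_⟩
  by_cases hθ : (isHermitian_realAdjMatrix G).eigenvalues₀ i = b 0
  · exfalso
    have hn := h.connected.nonempty
    let o : Fin (Fintype.card V) := ⟨0, Fintype.card_pos⟩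
    -- If a later eigenvalue equals the degree, so does the one of index 0. Both eigenfunctions are
    -- then nonzero constants and cannot be orthogonal.
    have hle : (b 0 : ℝ) ≤ (isHermitian_realAdjMatrix G).eigenvalues₀ o := by
      rw [← hθ]
      exact (isHermitian_realAdjMatrix G).eigenvalues₀_antitone (Nat.zero_le _)
    have hne : ∀ j, ∃ v, e j v ≠ 0 := by
      intro j
      by_contra! hj
      have := horth j j
      simp [hj] at this
    have hge : (isHermitian_realAdjMatrix G).eigenvalues₀ o ≤ b 0 := by
      obtain ⟨v, -, hv⟩ := exists_max_image (univ : Finset V) (fun v => |e o v|) univ_nonempty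
      refine (le_abs_self _).trans (h.abs_eigenvalue_le (heig o) (fun w => hv w (mem_univ w)) ?_)
      obtain ⟨w, hw⟩ := hne o
      have := hv w (mem_univ w)
      exact abs_pos.1 ((abs_pos.2 hw).trans_le this)
    have c1 := h.eq_of_eigenvalue_eq_degree (f := e i) (by rw [← hθ]; exact heig i)
    have c2 := h.eq_of_eigenvalue_eq_degree (f := e o) (by rw [hle.antisymm hge]; exact heig o)
    obtain ⟨v, hv⟩ := hne i
    obtain ⟨w, hw⟩ := hne o
    have := horth i o
    rw [if_neg (by intro h1; rw [h1] at hi; simp [o] at hi),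
      sum_congr rfl fun x _ => by rw [c1 x v, c2 x w], sum_const, nsmul_eq_mul] at this
    have hc : (#(univ : Finset V) : ℝ) ≠ 0 := by simp
    exact mul_ne_zero hc (mul_ne_zero hv hw) this
  · exact h.sum_eq_zero_of_eigenvalue_ne (heig i) hθ

/-- Nonnegativity of `r` covers the supremum over an empty index set, which is 0. -/
theorem zeroWeightSpectralRadius_le (h : IsDistanceRegular G d a b c) {r : ℝ} (hr : 0 ≤ r)
    (H : ∀ (θ : ℝ) (f : V → ℝ), (∀ v, ∑ y with G.Adj v y, f y = θ * f v) → ∑ v, f v = 0 →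
      f ≠ 0 → |θ| ≤ r) : zeroWeightSpectralRadius G ≤ r := by
  obtain ⟨e, horth, heig, -, hsum⟩ := h.exists_eigenfunctions_sum_eq_zero
  refine Real.iSup_le (fun i => H _ (e i.1) (heig i.1) (hsum i.1 i.2) ?_) hr
  intro h0
  have := horth i.1 i.1
  simp [h0] at this

/-- The quadratic form of the adjacency matrix is bounded in terms of the spectral gap. -/
theorem sum_mul_sum_adj_le (h : IsDistanceRegular G d a b c) {θ : ℝ}
    (hθ : zeroWeightSpectralRadius G ≤ θ) (f : V → ℝ) :
    ∑ v, f v * ∑ y with G.Adj v y, f y ≤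
      θ * ∑ v, f v ^ 2 + (b 0 - θ) * (∑ v, f v) ^ 2 / Fintype.card V := by
  obtain ⟨e, horth, heig, hpars, hsum⟩ := h.exists_eigenfunctions_sum_eq_zero
  have hn := h.connected.nonempty
  set lam := (isHermitian_realAdjMatrix G).eigenvalues₀ with hlam
  let o : Fin (Fintype.card V) := ⟨0, Fintype.card_pos⟩
  have hle : ∀ i : Fin (Fintype.card V), 1 ≤ i.val → lam i ≤ θ := by
    intro i hi
    refine (le_abs_self _).trans (le_trans ?_ hθ)
    exact le_ciSup (f := fun i : {i : Fin (Fintype.card V) // 1 ≤ i.val} => |lam i.val|)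
      (Set.finite_range _).bddAbove ⟨i, hi⟩
  have hne : ∀ i : Fin (Fintype.card V), i ≠ o → 1 ≤ i.val := by
    intro i hi
    by_contra! hc
    exact hi (Fin.ext (show i.val = 0 by omega))
  have hadj : ∀ i, ∑ x, e i x * ∑ y with G.Adj x y, f y = lam i * ∑ x, e i x * f x := by
    intro i
    simp_rw [sum_filter, mul_sum]
    rw [sum_comm]
    refine sum_congr rfl fun y _ => ?_
    rw [← mul_assoc, ← heig, sum_filter, sum_mul]
    refine sum_congr rfl fun x _ => ?_
    rw [G.adj_comm]
    split_ifs <;> simp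
  -- Parseval for the constant 1 and a point mass: only the index `o` survives, so `e o` is
  -- constant.
  have hone : ∀ x, (∑ y, e o y) * e o x = 1 := by
    intro x
    have := hpars (fun _ => 1) (Pi.single x 1)
    simp only [one_mul, mul_one] at this
    rw [sum_eq_single o] at this
    · simpa [Pi.single_apply] using this.symm
    · intro i _ hi
      rw [hsum i (hne i hi), zero_mul]
    · simp
  obtain ⟨x0⟩ := hn
  have hα : ∑ y, e o y ≠ 0 := by
    intro h0
    have := hone x0
    rw [h0] at this
    simp at this
  set α := ∑ y, e o y with hαdef
  have hconst : ∀ x, e o x = α⁻¹ := by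
    intro x
    exact eq_inv_of_mul_eq_one_right (hone x)
  have hlo : lam o = b 0 := by
    have := heig o x0
    rw [sum_congr rfl fun y _ => hconst y, hconst, sum_const, h.degree_eq, nsmul_eq_mul] at this
    exact (mul_right_cancel₀ (inv_ne_zero hα) this).symm
  have hcard : α⁻¹ ^ 2 = (Fintype.card V : ℝ)⁻¹ := by
    have := horth o o
    simp only [hconst, if_true, sum_const, card_univ, nsmul_eq_mul] at this
    rw [pow_two]
    exact eq_inv_of_mul_eq_one_right this
  have ho : (∑ x, e o x * f x) ^ 2 = (∑ x, f x) ^ 2 / Fintype.card V := by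
    simp_rw [hconst, ← mul_sum]
    rw [mul_pow, hcard]
    field_simp
  have h1 := hpars f (fun v => ∑ y with G.Adj v y, f y)
  have h2 := hpars f f
  simp_rw [← pow_two] at h2
  rw [h1, h2, mul_div_assoc, ← ho, mul_sum]
  have : ∀ i, (∑ x, e i x * f x) * ∑ x, e i x * ∑ y with G.Adj x y, f y ≤
      θ * (∑ x, e i x * f x) ^ 2 +
        if i = o then (b 0 - θ) * (∑ x, e o x * f x) ^ 2 else 0 := by
    intro i
    rw [hadj]
    split_ifs with hi
    · subst hi
      rw [hlo]
      linarith
    · have := mul_le_mul_of_nonneg_right (hle i (hne i hi)) (sq_nonneg (∑ x, e i x * f x))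
      linarith
  refine (sum_le_sum fun i _ => this i).trans_eq ?_
  rw [sum_add_distrib]
  simp

end IsDistanceRegular

/-! ### Existence of spectral-gap constants -/

namespace IsDistanceRegular
open Classical Finset

variable {V : Type*} [Fintype V] {G : SimpleGraph V} {d : ℕ} {a b c : ℕ → ℕ}

/-- Rapidly decreasing thresholds for the sequence `b`. -/
noncomputable def threshold (d : ℕ) : ℕ → ℝ
  | 0 => 1 / 2
  | j + 1 => threshold d j ^ 2 / (16 * d)

theorem threshold_bounds {d : ℕ} (hd : 0 < d) (j : ℕ) :
    0 < threshold d j ∧ threshold d j ≤ 1 / 2 ∧ threshold d (j + 1) ≤ threshold d j := by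
  have hdR : (1 : ℝ) ≤ d := by exact_mod_cast hd
  have step : ∀ x : ℝ, 0 < x → x ≤ 1 / 2 → x ^ 2 / (16 * d) ≤ x := by
    intro x h0 h1
    rw [div_le_iff₀ (by positivity)]
    nlinarith
  induction j with
  | zero => exact ⟨by norm_num [threshold], by norm_num [threshold],
      step _ (by norm_num [threshold]) (by norm_num [threshold])⟩
  | succ j ih =>
    obtain ⟨h1, h2, h3⟩ := ih
    have h4 : 0 < threshold d (j + 1) := by
      rw [threshold]
      positivity
    exact ⟨h4, h3.trans h2, step _ h4 (h3.trans h2)⟩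

theorem threshold_antitone {d : ℕ} (hd : 0 < d) : Antitone (threshold d) :=
  antitone_nat_of_succ_le fun j => (threshold_bounds hd j).2.2

/-- In a distance-regular graph, `b` is large below some index and `c` is large above it. -/
theorem exists_b_large_c_large (h : IsDistanceRegular G d a b c) (hd : 0 < d) :
    ∃ t, 1 ≤ t ∧ t ≤ d ∧ (∀ i < t, threshold d d * b 0 < b i) ∧
      ∀ i, t ≤ i → i < d → threshold d d * b 0 < c (i + 1) := by
  have hk := h.degree_pos hd
  -- The index `t` is the first at which `b` falls below the threshold of that index; the threshold
  -- recursion matches the relation between `D` and `δ` in `lt_c_succ_of_b_le`.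
  have hex : ∃ t, (b t : ℝ) ≤ threshold d t * b 0 := by
    refine ⟨d, ?_⟩
    rw [h.b_diam]
    have := (threshold_bounds hd d).1
    simp only [Nat.cast_zero]
    positivity
  have hmin := fun i (hi : i < Nat.find hex) => Nat.find_min hex hi
  have hspec := Nat.find_spec hex
  have hle : Nat.find hex ≤ d := by
    refine Nat.find_min' hex ?_
    rw [h.b_diam]
    have := (threshold_bounds hd d).1
    simp only [Nat.cast_zero]
    positivity
  generalize Nat.find hex = t at *
  have hb : ∀ i < t, threshold d i * b 0 < b i := fun i hi => not_le.1 (hmin i hi)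
  have ht : 1 ≤ t := by
    by_contra! h0
    have : t = 0 := by omega
    subst this
    rw [threshold] at hspec
    linarith
  refine ⟨t, ht, hle, fun i hi => lt_of_le_of_lt ?_ (hb i hi), fun i hti hid => ?_⟩
  · gcongr
    exact threshold_antitone hd (by omega)
  · have h1 := h.lt_c_succ_of_b_le (D := threshold d (t - 1)) (δ := threshold d t)
      (threshold_bounds hd _).1 (threshold_bounds hd _).2.1
      (by
        conv_lhs => rw [← Nat.sub_add_cancel ht]
        rw [threshold]) ht (by omega)
      (fun i hi => by
        refine le_trans ?_ (hb i (by omega)).le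
        gcongr
        exact threshold_antitone hd (by omega)) hspec
    have h2 : (c (t + 1) : ℝ) ≤ c (i + 1) := by
      exact_mod_cast h.c_mono (by omega) (by omega)
    refine lt_of_le_of_lt ?_ (h1.trans_le h2)
    gcongr
    exact threshold_antitone hd (by omega)

section Gap

variable {δ ε : ℝ} {t : ℕ}

/-- By `sphereCard_mul`, sphere sizes grow by a factor at least `δ / ε` at each step up to `t` and
shrink by at least as much afterwards, so the sphere of radius `t` dominates. -/
theorem mul_sphereCard_le (h : IsDistanceRegular G d a b c) (hd : 0 < d) (hδ : 0 < δ)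
    (hε0 : 0 < ε) (hεδ : ε ≤ δ)
    (hb : ∀ i < t, δ * b 0 < b i) (hc' : ∀ i < t, (c (i + 1) : ℝ) ≤ ε * b 0)
    (hc : ∀ i, t ≤ i → i < d → δ * b 0 < c (i + 1))
    (hb' : ∀ i, t ≤ i → i ≤ d → (b i : ℝ) ≤ ε * b 0)
    (v : V) {i : ℕ} (hid : i ≤ d) (hit : i ≠ t) :
    δ * sphereCard G v i ≤ ε * sphereCard G v t := by
  have hk := h.degree_pos hd
  have hK : ∀ i, (sphereCard G v i * b i : ℝ) = sphereCard G v (i + 1) * c (i + 1) := fun i => by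
    exact_mod_cast h.sphereCard_mul v i
  have hK0 : ∀ i, (0 : ℝ) ≤ sphereCard G v i := fun i => by positivity
  have up : ∀ i < t, δ * sphereCard G v i ≤ ε * sphereCard G v (i + 1) := by
    intro i hi
    refine le_of_mul_le_mul_right ?_ hk
    have h1 := mul_le_mul_of_nonneg_left (hb i hi).le (hK0 i)
    have h2 := mul_le_mul_of_nonneg_left (hc' i hi) (hK0 (i + 1))
    linarith [hK i]
  have down : ∀ i, t ≤ i → i < d → δ * sphereCard G v (i + 1) ≤ ε * sphereCard G v i := by
    intro i hi hid
    refine le_of_mul_le_mul_right ?_ hk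
    have h1 := mul_le_mul_of_nonneg_left (hb' i hi hid.le) (hK0 i)
    have h2 := mul_le_mul_of_nonneg_left (hc i hi hid).le (hK0 (i + 1))
    linarith [hK i]
  have cancel : ∀ x y : ℝ, 0 ≤ y → δ * x ≤ ε * y → x ≤ y := by
    intro x y hy hxy
    exact le_of_mul_le_mul_left (hxy.trans (by gcongr)) hδ
  rcases lt_or_gt_of_ne hit with hlt | hgt
  · have mono : ∀ j, i + 1 ≤ j → j ≤ t →
        (sphereCard G v (i + 1) : ℝ) ≤ sphereCard G v j := by
      intro j hj
      induction j, hj using Nat.le_induction with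
      | base => exact fun _ => le_rfl
      | succ j _ ih => exact fun hjt => (ih (by omega)).trans (cancel _ _ (hK0 _) (up j hjt))
    refine (up i hlt).trans ?_
    have := mono t hlt le_rfl
    gcongr
  · have mono : ∀ j, t ≤ j → j < i → (sphereCard G v j : ℝ) ≤ sphereCard G v t := by
      intro j hj
      induction j, hj using Nat.le_induction with
      | base => exact fun _ => le_rfl
      | succ j hj ih =>
        exact fun hji => (cancel _ _ (hK0 _) (down j hj (by omega))).trans (ih (by omega))
    obtain ⟨j, rfl⟩ : ∃ j, i = j + 1 := ⟨i - 1, by omega⟩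
    refine (down j (by omega) (by omega)).trans ?_
    have := mono j (by omega) (by omega)
    gcongr

/-- Sphere means of `f` about a maximum point of `|f|` satisfy a three-term recurrence. Their value
at `t` is tiny because `f` sums to zero and one sphere dominates; if `|θ|` were near the degree, the
recurrence would carry this smallness back to the centre. -/
theorem abs_eigenvalue_le_of_gap (h : IsDistanceRegular G d a b c) (hd : 0 < d) (hδ : 0 < δ)
    (hδ1 : δ ≤ 1 / 2) (hε : ε = δ / (2 * d * (4 / δ) ^ d)) (htd : t ≤ d)
    (hb : ∀ i < t, δ * b 0 < b i) (hc' : ∀ i < t, (c (i + 1) : ℝ) ≤ ε * b 0)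
    (hc : ∀ i, t ≤ i → i < d → δ * b 0 < c (i + 1))
    (hb' : ∀ i, t ≤ i → i ≤ d → (b i : ℝ) ≤ ε * b 0) {θ : ℝ} {f : V → ℝ}
    (hf : ∀ v, ∑ y with G.Adj v y, f y = θ * f v) (hsum : ∑ v, f v = 0) (hf0 : f ≠ 0) :
    |θ| ≤ b 0 * (1 - δ / 2) := by
  have hdR : (1 : ℝ) ≤ d := by exact_mod_cast hd
  have hQ : 1 ≤ 4 / δ := by rw [le_div_iff₀ hδ]; linarith
  have hQd : 1 ≤ (4 / δ) ^ d := one_le_pow₀ hQ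
  have hε0 : 0 < ε := by rw [hε]; positivity
  have hεδ : ε ≤ δ := by
    rw [hε]
    refine div_le_self hδ.le ?_
    nlinarith
  -- The value of `ε` is chosen for this: the smallness at `t`, amplified by `4 / δ` at most `d`
  -- times, remains half of the maximum.
  have hεQ : (4 / δ) ^ d * (d * (ε / δ)) = 1 / 2 := by
    rw [hε]
    field_simp
  have hk := h.degree_pos hd
  by_contra! hθ
  have hn := h.connected.nonempty
  obtain ⟨v, -, hv⟩ := exists_max_image (univ : Finset V) (fun v => |f v|) univ_nonempty
  have hM : 0 < |f v| := by
    obtain ⟨w, hw⟩ := Function.ne_iff.1 hf0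
    exact (abs_pos.2 hw).trans_le (hv w (mem_univ w))
  set M := |f v| with hMdef
  have hKpos : ∀ i ≤ d, (0 : ℝ) < sphereCard G v i := fun i hi => by
    exact_mod_cast h.sphereCard_pos v hi
  have hK : ∀ i, (sphereCard G v i * b i : ℝ) = sphereCard G v (i + 1) * c (i + 1) := fun i => by
    exact_mod_cast h.sphereCard_mul v i
  set s : ℕ → ℝ := fun i => ∑ x with G.dist v x = i, f x with hs
  have hsK : ∀ i, |s i| ≤ sphereCard G v i * M := by
    intro i
    refine (abs_sum_le_sum_abs _ _).trans ((sum_le_sum fun x _ => hv x (mem_univ x)).trans_eq ?_)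
    rw [sum_const, nsmul_eq_mul]
    rfl
  set u : ℕ → ℝ := fun i => s i / sphereCard G v i with hu
  have hus : ∀ i ≤ d, s i = sphereCard G v i * u i := by
    intro i hi
    have := hKpos i hi
    simp only [hu]
    field_simp
  have huM : ∀ i ≤ d, |u i| ≤ M := by
    intro i hi
    have h1 := hsK i
    rw [hus i hi, abs_mul, abs_of_pos (hKpos i hi)] at h1
    exact le_of_mul_le_mul_left h1 (hKpos i hi)
  have hrec : ∀ i, ∑ y, (step a b c (G.dist v y) i : ℝ) * f y = θ * s i := by
    intro i
    rw [← h.sum_sphere_sum_adj, hs, mul_sum]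
    exact sum_congr rfl fun x _ => hf x
  have hrec0 : θ * u 0 = b 0 * u 1 := by
    have h1 := hrec 0
    rw [h.sum_step_zero_mul] at h1
    change (c 1 : ℝ) * s 1 = θ * s 0 at h1
    rw [hus 0 (by omega), hus 1 (by omega)] at h1
    have h2 := hK 0
    rw [h.sphereCard_zero] at h1 h2
    simp only [Nat.cast_one, one_mul, zero_add] at h1 h2
    rw [h2, ← h1]
    ring
  have hrec1 : ∀ i, i + 2 ≤ d →
      θ * u (i + 1) = c (i + 1) * u i + a (i + 1) * u (i + 1) + b (i + 1) * u (i + 2) := by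
    intro i hi
    have h1 := hrec (i + 1)
    rw [sum_step_mul] at h1
    change a (i + 1) * s (i + 1) + b i * s i + c (i + 2) * s (i + 2) = θ * s (i + 1) at h1
    rw [hus i (by omega), hus (i + 1) (by omega), hus (i + 2) (by omega)] at h1
    have h2 := hK i
    have h3 := hK (i + 1)
    refine mul_left_cancel₀ (hKpos (i + 1) (by omega)).ne' ?_
    linear_combination -h1 + u i * h2 - u (i + 2) * h3
  -- For `i > 0`, the coefficient `|θ| - a i` is at least `b 0 * δ / 2`, since `b i` exceeds `δ * b
  -- 0`, and the inward term is negligible since `c i` is at most `ε * b 0`.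
  have hstep : ∀ i < t, δ / 2 * |u i| ≤ ε * M + |u (i + 1)| := by
    intro i hit
    rcases i with _ | i
    · have h1 : |θ| * |u 0| = b 0 * |u 1| := by
        rw [← abs_mul, hrec0, abs_mul, Nat.abs_cast]
      refine le_of_mul_le_mul_left ?_ hk
      have h2 : b 0 * (1 - δ / 2) * |u 0| ≤ |θ| * |u 0| := by gcongr
      have h3 : b 0 * (δ / 2) * |u 0| ≤ b 0 * (1 - δ / 2) * |u 0| := by
        gcongr
        linarith
      have h4 : 0 ≤ b 0 * (ε * M) := by positivity
      simp only [zero_add]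
      linarith
    · have hbi : (b (i + 1) : ℝ) ≤ b 0 := by exact_mod_cast h.b_anti (Nat.zero_le _) (by omega)
      by_cases hi : i + 2 ≤ d
      · have h1 : |θ| * |u (i + 1)| ≤
            c (i + 1) * |u i| + a (i + 1) * |u (i + 1)| + b (i + 1) * |u (i + 2)| := by
          rw [← abs_mul, hrec1 i hi]
          refine (abs_add_three _ _ _).trans_eq ?_
          simp only [abs_mul, Nat.abs_cast]
        have h2 : (c (i + 1) : ℝ) * |u i| ≤ ε * b 0 * M := by
          gcongr
          · exact hc' i (by omega)
          · exact huM i (by omega)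
        have h3 : (b (i + 1) : ℝ) * |u (i + 2)| ≤ b 0 * |u (i + 2)| := by gcongr
        have h4 : (a (i + 1) + b (i + 1) + c (i + 1) : ℝ) = b 0 := by
          exact_mod_cast h.sum_eq (by omega)
        have h5 := hb (i + 1) hit
        have h6 : (0 : ℝ) ≤ c (i + 1) := by positivity
        have h7 : b 0 * (δ / 2) * |u (i + 1)| ≤ (|θ| - a (i + 1)) * |u (i + 1)| := by
          gcongr
          linarith
        refine le_of_mul_le_mul_left ?_ hk
        linarith
      · omega
  have hut : |u t| ≤ d * (ε / δ) * M := by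
    have h1 : ∑ i ∈ range (d + 1), s i = 0 := by
      rw [← hsum, hs]
      refine sum_fiberwise_of_maps_to (fun x _ => ?_) _
      rw [mem_range]
      have := h.dist_le v x
      omega
    have ht : t ∈ range (d + 1) := by rw [mem_range]; omega
    rw [← add_sum_erase _ _ ht] at h1
    have h2 : |s t| ≤ ∑ i ∈ (range (d + 1)).erase t, |s i| := by
      rw [eq_neg_of_add_eq_zero_left h1, abs_neg]
      exact abs_sum_le_sum_abs _ _
    have h3 : ∑ i ∈ (range (d + 1)).erase t, |s i| ≤
        ∑ i ∈ (range (d + 1)).erase t, ε / δ * sphereCard G v t * M := by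
      refine sum_le_sum fun i hi => (hsK i).trans ?_
      rw [mem_erase, mem_range] at hi
      have := h.mul_sphereCard_le hd hδ hε0 hεδ hb hc' hc hb' v (i := i) (by omega) hi.1
      gcongr
      rw [div_mul_eq_mul_div, le_div_iff₀ hδ]
      linarith
    rw [sum_const, card_erase_of_mem ht, card_range, Nat.add_sub_cancel, nsmul_eq_mul] at h3
    have h4 := h2.trans h3
    rw [hus t htd, abs_mul, abs_of_pos (hKpos t htd)] at h4
    refine le_of_mul_le_mul_left ?_ (hKpos t htd)
    linarith
  have hdown : ∀ j ≤ t, |u (t - j)| ≤ (4 / δ) ^ j * (d * (ε / δ) * M) := by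
    intro j
    induction j with
    | zero => simpa using hut
    | succ j ih =>
      intro hj
      have h1 := ih (by omega)
      have h2 := hstep (t - (j + 1)) (by omega)
      rw [show t - (j + 1) + 1 = t - j by omega] at h2
      -- The error term is absorbed into the inductive bound, which turns the factor `2 / δ` into `4
      -- / δ`.
      have h3 : ε * M ≤ (4 / δ) ^ j * (d * (ε / δ) * M) := by
        have e1 : 1 ≤ (4 / δ) ^ j := one_le_pow₀ hQ
        have e2 : ε ≤ ε / δ := by rw [le_div_iff₀ hδ]; nlinarith
        have e3 : ε ≤ d * (ε / δ) := by nlinarith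
        have e4 : ε * M ≤ d * (ε / δ) * M := by gcongr
        have e5 : 0 ≤ ε * M := by positivity
        nlinarith
      have h4 : |u (t - (j + 1))| ≤ 2 / δ * (ε * M + |u (t - j)|) := by
        rw [div_mul_eq_mul_div, le_div_iff₀ hδ]
        linarith
      refine h4.trans ?_
      rw [pow_succ]
      calc 2 / δ * (ε * M + |u (t - j)|)
          ≤ 2 / δ * ((4 / δ) ^ j * (d * (ε / δ) * M) + (4 / δ) ^ j * (d * (ε / δ) * M)) := by
            gcongr
        _ = _ := by ring
  have h0 := hdown t le_rfl
  rw [Nat.sub_self] at h0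
  have hu0 : |u 0| = M := by
    have : s 0 = f v := by
      change ∑ x with G.dist v x = 0, f x = f v
      rw [sum_eq_single v]
      · intro x hx hxv
        exact absurd (h.connected.dist_eq_zero_iff.1 (mem_filter.1 hx).2).symm hxv
      · simp
    rw [hu]
    simp only [this, h.sphereCard_zero, Nat.cast_one, div_one]
    rfl
  rw [hu0] at h0
  have h1 : (4 / δ) ^ t * (d * (ε / δ) * M) ≤ (4 / δ) ^ d * (d * (ε / δ) * M) := by
    gcongr
  have h2 : (4 / δ) ^ d * (d * (ε / δ) * M) = 1 / 2 * M := by rw [← hεQ]; ring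
  linarith

end Gap

end IsDistanceRegular

/-- Spectral-gap constants exist for every diameter. -/
theorem exists_areSpectralGapConstants (d : ℕ) (hd : 0 < d) :
    ∃ ε η : ℝ, η < 1 / 2 ∧ AreSpectralGapConstants.{u} d ε η := by
  obtain ⟨hδ, hδ1, -⟩ := IsDistanceRegular.threshold_bounds hd d
  set δ := IsDistanceRegular.threshold d d with hδdef
  have hdR : (1 : ℝ) ≤ d := by exact_mod_cast hd
  have hQ : 1 ≤ 4 / δ := by rw [le_div_iff₀ hδ]; linarith
  have hQd : 1 ≤ (4 / δ) ^ d := one_le_pow₀ hQ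
  refine ⟨δ / (2 * d * (4 / δ) ^ d), δ / 2, by linarith, by positivity, by linarith, ?_⟩
  intro V _ G a b c h
  set ε := δ / (2 * d * (4 / δ) ^ d) with hε
  have hεδ : ε ≤ δ := by
    rw [hε]
    refine div_le_self hδ.le ?_
    nlinarith
  have hε0 : 0 < ε := by positivity
  by_cases hlarge : ∃ i < d, ε * (b 0 : ℝ) < b i ∧ ε * (b 0 : ℝ) < c (i + 1)
  · exact Or.inl hlarge
  right
  push Not at hlarge
  have hk := h.degree_pos hd
  have hle : ε * (b 0 : ℝ) ≤ δ * b 0 := by gcongr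
  obtain ⟨t, -, htd, hb, hc⟩ := h.exists_b_large_c_large hd
  refine h.zeroWeightSpectralRadius_le (mul_nonneg hk.le (by linarith)) fun θ f hf hsum hf0 => ?_
  refine h.abs_eigenvalue_le_of_gap hd hδ hδ1 hε htd hb
    (fun i hi => hlarge i (by omega) (hle.trans_lt (hb i hi))) hc (fun i hti hid => ?_) hf hsum hf0
  rcases hid.eq_or_lt with rfl | hid
  · rw [h.b_diam]
    simp only [Nat.cast_zero]
    positivity
  · by_contra! hbi
    exact absurd (hlarge i hid hbi) (not_le.2 (hle.trans_lt (hc i hti hid)))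

/-! ### Line systems and their automorphisms -/

open Classical Finset in
/-- A system `𝒞` of cliques of size `L` (lines), `r` of them through each vertex, which partitions
the edges of a graph in which nonadjacent vertices have at most one common neighbour. -/
structure IsLineSystem {V : Type*} (G : SimpleGraph V) (𝒞 : Finset (Finset V))
    (L r : ℕ) : Prop where
  clique : ∀ C ∈ 𝒞, G.IsClique (C : Set V)
  card_eq : ∀ C ∈ 𝒞, #C = L
  existsUnique : ∀ u v, G.Adj u v → ∃! C : Finset V, C ∈ 𝒞 ∧ u ∈ C ∧ v ∈ C
  card_lines : ∀ x, #{C ∈ 𝒞 | x ∈ C} = r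
  lt : r < L
  two_le : 2 ≤ r
  eq_of_common : ∀ x y, x ≠ y → ¬ G.Adj x y → ∀ p q, G.Adj x p → G.Adj y p → G.Adj x q →
    G.Adj y q → p = q

namespace IsLineSystem
open Classical Finset

variable {V : Type*} {G : SimpleGraph V} {𝒞 : Finset (Finset V)} {L r : ℕ}

theorem adj (h : IsLineSystem G 𝒞 L r) {C : Finset V} (hC : C ∈ 𝒞) {x y : V} (hx : x ∈ C)
    (hy : y ∈ C) (hxy : x ≠ y) : G.Adj x y :=
  h.clique C hC (mem_coe.2 hx) (mem_coe.2 hy) hxy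

theorem line_eq (h : IsLineSystem G 𝒞 L r) {C D : Finset V} (hC : C ∈ 𝒞) (hD : D ∈ 𝒞)
    {x y : V} (hxy : x ≠ y) (hxC : x ∈ C) (hyC : y ∈ C) (hxD : x ∈ D) (hyD : y ∈ D) : C = D :=
  (h.existsUnique x y (h.adj hC hxC hyC hxy)).unique ⟨hC, hxC, hyC⟩ ⟨hD, hxD, hyD⟩

/-- A vertex adjacent to two vertices of a line lies on the line. -/
theorem mem_of_adj (h : IsLineSystem G 𝒞 L r) {C : Finset V} (hC : C ∈ 𝒞) {x y z : V}
    (hy : y ∈ C) (hz : z ∈ C) (hyz : y ≠ z) (hxy : G.Adj x y) (hxz : G.Adj x z) : x ∈ C := by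
  by_contra hx
  -- If `x` off `C` is adjacent to all of `C`, the lines joining it to the points of `C` are
  -- distinct, giving `L ≤ r`. Otherwise `x` and some nonadjacent `w` in `C` have the two common
  -- neighbours `y`, `z`.
  by_cases hall : ∀ w ∈ C, G.Adj x w
  · have hex : ∀ w, ∃ D : Finset V, w ∈ C → D ∈ 𝒞 ∧ x ∈ D ∧ w ∈ D := by
      intro w
      by_cases hw : w ∈ C
      · obtain ⟨D, hD, -⟩ := h.existsUnique x w (hall w hw)
        exact ⟨D, fun _ => hD⟩
      · exact ⟨∅, fun hw' => absurd hw' hw⟩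
    choose D hD using hex
    have hle : #C ≤ #{C ∈ 𝒞 | x ∈ C} := by
      refine card_le_card_of_injOn D (fun w hw => ?_) ?_
      · have := hD w hw
        exact mem_coe.2 (mem_filter.2 ⟨this.1, this.2.1⟩)
      · intro w hw w' hw' heq
        by_contra hne
        obtain ⟨h1, h2, h3⟩ := hD w hw
        have h4 := (hD w' hw').2.2
        rw [← heq] at h4
        have := h.line_eq hC h1 hne hw hw' h3 h4
        rw [← this] at h2
        exact hx h2
    rw [h.card_lines, h.card_eq C hC] at hle
    exact absurd h.lt (not_lt.2 hle)
  · push Not at hall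
    obtain ⟨w, hw, hxw⟩ := hall
    have hwy : w ≠ y := by rintro rfl; exact hxw hxy
    have hwz : w ≠ z := by rintro rfl; exact hxw hxz
    have hwx : x ≠ w := by rintro rfl; exact hx hw
    exact hyz (h.eq_of_common x w hwx hxw y z hxy (h.adj hC hw hy hwy) hxz (h.adj hC hw hz hwz))

/-- Automorphisms permute the lines. -/
theorem image_mem (h : IsLineSystem G 𝒞 L r) (σ : G ≃g G) {C : Finset V} (hC : C ∈ 𝒞) :
    C.image σ ∈ 𝒞 := by
  have hL : 1 < #C := by
    rw [h.card_eq C hC]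
    have := h.lt
    have := h.two_le
    omega
  obtain ⟨x, hx, y, hy, hxy⟩ := one_lt_card.1 hL
  have hadj : G.Adj (σ x) (σ y) := σ.map_adj_iff.2 (h.adj hC hx hy hxy)
  obtain ⟨D, ⟨hD, hxD, hyD⟩, -⟩ := h.existsUnique _ _ hadj
  have hsub : C.image σ ⊆ D := by
    intro w hw
    obtain ⟨z, hz, rfl⟩ := mem_image.1 hw
    by_cases hzx : z = x
    · rwa [hzx]
    by_cases hzy : z = y
    · rwa [hzy]
    exact h.mem_of_adj hD hxD hyD hadj.ne (σ.map_adj_iff.2 (h.adj hC hz hx hzx))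
      (σ.map_adj_iff.2 (h.adj hC hz hy hzy))
  have : C.image σ = D := by
    refine eq_of_subset_of_card_le hsub ?_
    rw [card_image_of_injective _ σ.injective, h.card_eq C hC, h.card_eq D hD]
  rwa [this]

/-- The fixed lines meeting a moved line all meet it in the same vertex. -/
theorem eq_of_mem_fixed (h : IsLineSystem G 𝒞 L r) (σ : G ≃g G) {C D D' : Finset V}
    (hC : C ∈ 𝒞) (hCσ : C.image σ ≠ C) (hD : D ∈ 𝒞) (hDσ : D.image σ = D) (hD' : D' ∈ 𝒞)
    (hDσ' : D'.image σ = D') {x x' : V} (hx : x ∈ C) (hxD : x ∈ D) (hx' : x' ∈ C)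
    (hxD' : x' ∈ D') : x = x' := by
  by_contra hne
  have hyD : σ x ∈ D := hDσ ▸ mem_image_of_mem σ hxD
  have hyD' : σ x' ∈ D' := hDσ' ▸ mem_image_of_mem σ hxD'
  have hC1 := h.image_mem σ hC
  have hy1 : σ x ∈ C.image σ := mem_image_of_mem σ hx
  have hy1' : σ x' ∈ C.image σ := mem_image_of_mem σ hx'
  have hyy : G.Adj (σ x) (σ x') := σ.map_adj_iff.2 (h.adj hC hx hx' hne)
  -- If `z` and `σ z` were distinct points of both `C` and a fixed line, then `C` would be that
  -- line.
  have hfix : ∀ {E : Finset V} {z : V}, E ∈ 𝒞 → E.image σ = E → z ∈ C → z ∈ E → σ z ∈ E →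
      σ z ∈ C → σ z = z := by
    intro E z hE hEσ hzC hzE hσE hσC
    by_contra hz
    have := h.line_eq hE hC hz hσE hzE hσC hzC
    rw [this] at hEσ
    exact hCσ hEσ
  by_cases hyC : σ x ∈ C
  · have e := hfix hD hDσ hx hxD hyD hyC
    by_cases hyC' : σ x' ∈ C
    · have e' := hfix hD' hDσ' hx' hxD' hyD' hyC'
      exact hCσ (h.line_eq hC1 hC hyy.ne hy1 hy1' hyC hyC')
    · refine hyC' (h.mem_of_adj hC hx hx' hne ?_ (h.adj hD' hyD' hxD' ?_))
      · rw [e] at hyy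
        exact hyy.symm
      · intro e'
        rw [e'] at hyC'
        exact hyC' hx'
  · have hxy : σ x ≠ x := fun e => hyC (by rwa [e])
    have hadj := h.adj hD hyD hxD hxy
    by_cases hyC' : σ x' ∈ C
    · have e' := hfix hD' hDσ' hx' hxD' hyD' hyC'
      refine hyC (h.mem_of_adj hC hx hx' hne hadj ?_)
      rw [e'] at hyy
      exact hyy
    · have hxy' : σ x' ≠ x' := fun e => hyC' (by rwa [e])
      have hadj' := h.adj hD' hyD' hxD' hxy'
      -- The remaining case is the quadrangle `x`, `x'`, `σ x'`, `σ x`: the nonadjacent `σ x` and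
      -- `x'` have common neighbours `x` and `σ x'`, which must coincide.
      have hnadj : ¬ G.Adj (σ x) x' := fun h1 => hyC (h.mem_of_adj hC hx hx' hne hadj h1)
      have hne' : σ x ≠ x' := fun e => hyC (by rwa [e])
      have := h.eq_of_common (σ x) x' hne' hnadj x (σ x') hadj (h.adj hC hx' hx (Ne.symm hne)) hyy
        hadj'.symm
      rw [← this] at hyC'
      exact hyC' hx

/-- If every line were fixed, two different lines through `x` would also share `σ x`. -/
theorem exists_image_ne (h : IsLineSystem G 𝒞 L r) {σ : G ≃g G} {x : V} (hx : σ x ≠ x) :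
    ∃ C ∈ 𝒞, C.image σ ≠ C := by
  by_contra! hall
  have hr : 1 < #{C ∈ 𝒞 | x ∈ C} := by rw [h.card_lines]; exact h.two_le
  obtain ⟨C, hC, D, hD, hCD⟩ := one_lt_card.1 hr
  rw [mem_filter] at hC hD
  refine hCD (h.line_eq hC.1 hD.1 hx ?_ hC.2 ?_ hD.2)
  · rw [← hall C hC.1]
    exact mem_image_of_mem σ hC.2
  · rw [← hall D hD.1]
    exact mem_image_of_mem σ hD.2

/-- The number of lines through `x` which belong to `S`. -/
noncomputable def lineCount (S : Finset (Finset V)) (x : V) : ℕ := #{C ∈ S | x ∈ C}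

/-- The moved lines through the vertices of a moved line, counted with multiplicity. -/
theorem le_sum_lineCount (h : IsLineSystem G 𝒞 L r) (σ : G ≃g G) {C : Finset V} (hC : C ∈ 𝒞)
    (hCσ : C.image σ ≠ C) :
    (r * (L - 1) : ℝ) ≤ ∑ x ∈ C, (lineCount {D ∈ 𝒞 | D.image σ ≠ D} x : ℝ) := by
  have hsplit : ∀ x, lineCount {D ∈ 𝒞 | D.image σ ≠ D} x +
      lineCount {D ∈ 𝒞 | D.image σ = D} x = r := by
    intro x
    unfold lineCount
    rw [filter_filter, filter_filter, ← h.card_lines x, add_comm]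
    simp_rw [and_comm (b := x ∈ _)]
    rw [← filter_filter, ← filter_filter]
    exact card_filter_add_card_filter_not _
  -- Only one vertex of `C` can lie on fixed lines, and it lies on at most `r`.
  have hfix : ∑ x ∈ C, lineCount {D ∈ 𝒞 | D.image σ = D} x ≤ r := by
    by_cases hex : ∃ p ∈ C, ∃ D ∈ 𝒞, D.image σ = D ∧ p ∈ D
    · obtain ⟨p, hp, D, hD, hDσ, hpD⟩ := hex
      rw [sum_eq_single_of_mem p hp]
      · rw [← hsplit p]
        omega
      · intro x hx hxp
        unfold lineCount
        rw [card_eq_zero, filter_eq_empty_iff]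
        intro E hE hxE
        rw [mem_filter] at hE
        exact hxp (h.eq_of_mem_fixed σ hC hCσ hE.1 hE.2 hD hDσ hx hxE hp hpD)
    · push Not at hex
      rw [sum_eq_zero]
      · omega
      · intro x hx
        unfold lineCount
        rw [card_eq_zero, filter_eq_empty_iff]
        intro E hE hxE
        rw [mem_filter] at hE
        exact hex x hx E hE.1 hE.2 hxE
  have hall : ∑ x ∈ C, (lineCount {D ∈ 𝒞 | D.image σ ≠ D} x : ℝ) +
      ∑ x ∈ C, (lineCount {D ∈ 𝒞 | D.image σ = D} x : ℝ) = L * r := by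
    rw [← sum_add_distrib, ← h.card_eq C hC, ← nsmul_eq_mul, ← sum_const]
    refine sum_congr rfl fun x _ => ?_
    exact_mod_cast hsplit x
  have hfix' : ∑ x ∈ C, (lineCount {D ∈ 𝒞 | D.image σ = D} x : ℝ) ≤ r := by exact_mod_cast hfix
  linarith

/-! ### Spectral counting of moved lines and moved vertices -/

section Counting

variable [Fintype V]

theorem sum_lineCount_mul (S : Finset (Finset V)) (f : V → ℝ) :
    ∑ x, (lineCount S x : ℝ) * f x = ∑ C ∈ S, ∑ x ∈ C, f x := by
  have : ∀ x, (lineCount S x : ℝ) * f x = ∑ C ∈ S, if x ∈ C then f x else 0 := by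
    intro x
    rw [← sum_filter, sum_const, nsmul_eq_mul]
    rfl
  rw [sum_congr rfl fun x _ => this x, sum_comm]
  refine sum_congr rfl fun C _ => ?_
  rw [← sum_filter]
  simp

/-- The squares of the line sums of `f`, expressed by the adjacency matrix. -/
theorem sum_sq_line (h : IsLineSystem G 𝒞 L r) (f : V → ℝ) :
    ∑ C ∈ 𝒞, (∑ x ∈ C, f x) ^ 2 =
      r * ∑ x, f x ^ 2 + ∑ x, f x * ∑ y with G.Adj x y, f y := by
  have h1 : ∀ C ∈ 𝒞, (∑ x ∈ C, f x) ^ 2 =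
      ∑ x, ∑ y, if x ∈ C ∧ y ∈ C then f x * f y else 0 := by
    intro C _
    rw [pow_two, sum_mul_sum]
    have : ∀ x, (∑ y, if x ∈ C ∧ y ∈ C then f x * f y else 0) =
        if x ∈ C then ∑ y ∈ C, f x * f y else 0 := by
      intro x
      split_ifs with hx <;> simp [hx]
    rw [sum_congr rfl fun x _ => this x]
    simp
  rw [sum_congr rfl h1, sum_comm, mul_sum, ← sum_add_distrib]
  refine sum_congr rfl fun x _ => ?_
  rw [sum_comm, sum_filter, mul_sum]
  -- The entries of `N Nᵀ`: `r` on the diagonal, and off it 1 or 0 according to adjacency.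
  have h2 : ∀ y, (∑ C ∈ 𝒞, if x ∈ C ∧ y ∈ C then f x * f y else 0) =
      (if y = x then r * f x ^ 2 else 0) + f x * if G.Adj x y then f y else 0 := by
    intro y
    rw [← sum_filter, sum_const, nsmul_eq_mul]
    by_cases hyx : y = x
    · subst hyx
      simp only [and_self, h.card_lines, if_true, SimpleGraph.irrefl, if_false]
      ring
    by_cases hadj : G.Adj x y
    · obtain ⟨D, hD, hDu⟩ := h.existsUnique x y hadj
      have : ({C ∈ 𝒞 | x ∈ C ∧ y ∈ C} : Finset (Finset V)) = {D} := by
        ext C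
        rw [mem_filter, mem_singleton]
        exact ⟨hDu C, by rintro rfl; exact hD⟩
      rw [this]
      simp [hyx, hadj]
    · have : ({C ∈ 𝒞 | x ∈ C ∧ y ∈ C} : Finset (Finset V)) = ∅ := by
        rw [filter_eq_empty_iff]
        rintro C hC ⟨h3, h4⟩
        exact hadj (h.adj hC h3 h4 (Ne.symm hyx))
      rw [this]
      simp [hyx, hadj]
  rw [sum_congr rfl fun y _ => h2 y, sum_add_distrib]
  simp

/-- A moved line contains at most one fixed vertex. -/
theorem card_moved_mul_le (h : IsLineSystem G 𝒞 L r) (σ : G ≃g G) :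
    (#{D ∈ 𝒞 | D.image σ ≠ D} : ℝ) * (L - 1) ≤ r * #{x | σ x ≠ x} := by
  have h1 := sum_lineCount_mul {D ∈ 𝒞 | D.image σ ≠ D} (fun x => if σ x ≠ x then 1 else 0)
  have h2 : ∑ x, (lineCount {D ∈ 𝒞 | D.image σ ≠ D} x : ℝ) * (if σ x ≠ x then 1 else 0) ≤
      ∑ x, (r : ℝ) * (if σ x ≠ x then 1 else 0) := by
    refine sum_le_sum fun x _ => ?_
    gcongr
    rw [← h.card_lines x]
    exact card_le_card (filter_subset_filter _ (filter_subset _ _))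
  rw [← mul_sum, sum_boole] at h2
  refine le_trans ?_ (h1.symm.le.trans h2)
  rw [← nsmul_eq_mul, ← sum_const]
  refine sum_le_sum fun C hC => ?_
  rw [mem_filter] at hC
  rw [sum_boole]
  -- Two fixed vertices of `C` would lie on both `C` and its image, making these equal.
  have h3 : #{x ∈ C | σ x = x} ≤ 1 := by
    rw [card_le_one]
    intro x hx y hy
    rw [mem_filter] at hx hy
    by_contra hxy
    refine hC.2 (h.line_eq (h.image_mem σ hC.1) hC.1 hxy ?_ ?_ hx.1 hy.1)
    · exact mem_image.2 ⟨x, hx⟩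
    · exact mem_image.2 ⟨y, hy⟩
  have h4 : #{x ∈ C | σ x = x} + #{x ∈ C | ¬ σ x = x} = #C :=
    card_filter_add_card_filter_not _
  rw [h.card_eq C hC.1] at h4
  have h5 : (L : ℝ) ≤ #{x ∈ C | ¬ σ x = x} + 1 := by exact_mod_cast (by omega)
  linarith

/-- A nontrivial automorphism of a graph with a line system and a spectral gap moves a positive
proportion of the vertices. -/
theorem mul_card_le_card_moved (h : IsLineSystem G 𝒞 L r) {k θ : ℝ}
    (hk : (r * (L - 1) : ℝ) = k) (hgap : 4 * r ≤ k - θ)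
    (hquad : ∀ f : V → ℝ, ∑ v, f v * ∑ y with G.Adj v y, f y ≤
      θ * ∑ v, f v ^ 2 + (k - θ) * (∑ v, f v) ^ 2 / Fintype.card V)
    {σ : G ≃g G} {x : V} (hx : σ x ≠ x) :
    (3 / 16 * Fintype.card V : ℝ) ≤ #{x | σ x ≠ x} := by
  have hr2 : (2 : ℝ) ≤ r := by exact_mod_cast h.two_le
  have hL : (3 : ℝ) ≤ L := by
    have := h.lt
    have := h.two_le
    exact_mod_cast (by omega : 3 ≤ L)
  have hn : (0 : ℝ) < Fintype.card V := by
    have : Nonempty V := ⟨x⟩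
    exact_mod_cast Fintype.card_pos
  have hk0 : 0 < k := by rw [← hk]; exact mul_pos (by linarith) (by linarith)
  set S : Finset (Finset V) := {D ∈ 𝒞 | D.image σ ≠ D} with hS
  have hs : (0 : ℝ) < #S := by
    obtain ⟨C, hC, hCσ⟩ := h.exists_image_ne hx
    have : 0 < #S := card_pos.2 ⟨C, mem_filter.2 ⟨hC, hCσ⟩⟩
    exact_mod_cast this
  set n : ℝ := ((Fintype.card V : ℕ) : ℝ) with hndef
  set g : V → ℝ := fun x => lineCount S x with hg
  set P : ℝ := ∑ x, g x ^ 2 with hP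
  have hPC : P = ∑ C ∈ S, ∑ x ∈ C, g x := by
    rw [← sum_lineCount_mul, hP]
    exact sum_congr rfl fun x _ => pow_two _
  have hsum : ∑ x, g x = #S * L := by
    have := sum_lineCount_mul S (fun _ => 1)
    simp only [mul_one] at this
    rw [hg, this, ← nsmul_eq_mul, ← sum_const]
    refine sum_congr rfl fun C hC => ?_
    rw [← h.card_eq C (mem_filter.1 hC).1]
    simp
  have hPk : #S * k ≤ P := by
    rw [hPC, ← nsmul_eq_mul, ← sum_const]
    refine sum_le_sum fun C hC => ?_
    rw [← hk]
    exact h.le_sum_lineCount σ (mem_filter.1 hC).1 (mem_filter.1 hC).2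
  -- Cauchy–Schwarz over the moved lines, then enlargement of the sum to all lines so that
  -- `sum_sq_line` and the spectral bound apply.
  have hPP : P ^ 2 ≤ #S * ((r + θ) * P + (k - θ) * (#S * L) ^ 2 / n) := by
    rw [hPC]
    refine sq_sum_le_card_mul_sum_sq.trans ?_
    gcongr
    have h1 : ∑ C ∈ S, (∑ x ∈ C, g x) ^ 2 ≤ ∑ C ∈ 𝒞, (∑ x ∈ C, g x) ^ 2 :=
      sum_le_sum_of_subset_of_nonneg (filter_subset _ _) fun _ _ _ => sq_nonneg _
    rw [h.sum_sq_line] at h1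
    have h2 := hquad g
    rw [hsum] at h2
    rw [← hPC]
    linarith
  have hmain : 3 / 4 * k * n ≤ #S * (L : ℝ) ^ 2 := by
    have hkθ : 0 < k - θ := by linarith
    have h1 : P * (P - #S * (r + θ)) ≤ #S ^ 3 * ((k - θ) * L ^ 2 / n) := by
      have e : (#S : ℝ) ^ 3 * ((k - θ) * L ^ 2 / n) = #S * ((k - θ) * (#S * L) ^ 2 / n) := by ring
      rw [e]
      linarith
    -- Uses `#S * k ≤ P` in both factors; the hypothesis `4 * r ≤ k - θ` leaves three quarters of
    -- the gap.
    have h2 : #S * k * (#S * (3 / 4 * (k - θ))) ≤ P * (P - #S * (r + θ)) := by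
      gcongr
      have : (#S : ℝ) * (3 / 4 * (k - θ)) ≤ #S * (k - (r + θ)) := by
        gcongr
        linarith
      linarith
    have h3 : ((#S : ℝ) ^ 2 * (k - θ)) * (3 / 4 * k) ≤
        (#S ^ 2 * (k - θ)) * (#S * L ^ 2 / n) := by
      calc ((#S : ℝ) ^ 2 * (k - θ)) * (3 / 4 * k) = #S * k * (#S * (3 / 4 * (k - θ))) := by ring
        _ ≤ _ := h2.trans h1
        _ = _ := by ring
    have h4 := le_of_mul_le_mul_left h3 (by positivity)
    rwa [le_div_iff₀ hn] at h4
  have hU := h.card_moved_mul_le σ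
  rw [← hS] at hU
  set U : ℝ := (#{x | σ x ≠ x} : ℝ) with hUdef
  have h1 : (r : ℝ) * (3 / 4 * (L - 1) ^ 2 * n) ≤ r * (U * L ^ 2) := by
    calc (r : ℝ) * (3 / 4 * (L - 1) ^ 2 * n) = 3 / 4 * k * n * (L - 1) := by rw [← hk]; ring
      _ ≤ #S * (L : ℝ) ^ 2 * (L - 1) := mul_le_mul_of_nonneg_right hmain (by linarith)
      _ = #S * (L - 1) * (L : ℝ) ^ 2 := by ring
      _ ≤ r * U * (L : ℝ) ^ 2 := by gcongr
      _ = _ := by ring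
  have h2 := le_of_mul_le_mul_left h1 (by linarith)
  -- Replacing `L - 1` by `L / 2` turns the constant `3 / 4` into `3 / 16`.
  have h3 : (L : ℝ) ^ 2 / 4 ≤ (L - 1) ^ 2 := by nlinarith
  have h4 : (L : ℝ) ^ 2 * (3 / 16 * n) ≤ L ^ 2 * U := by
    calc (L : ℝ) ^ 2 * (3 / 16 * n) = 3 / 4 * (L ^ 2 / 4) * n := by ring
      _ ≤ 3 / 4 * (L - 1) ^ 2 * n := by gcongr
      _ ≤ _ := by linarith
  exact le_of_mul_le_mul_left h4 (by positivity)

end Counting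

end IsLineSystem

/-! ### From Delsarte cliques to the motion bound -/

open Classical Finset in
/-- The Delsarte cliques of a geometric distance-regular graph with `μ = 1` form a line system. -/
theorem IsGeometric.exists_isLineSystem {V : Type*} [Fintype V] {G : SimpleGraph V} {d : ℕ}
    {a b c : ℕ → ℕ} {m : ℝ} (hG : IsGeometric G (b 0)) (h : IsDistanceRegular G d a b c)
    (hd : 2 ≤ d) (hc2 : c 2 = 1) (hm : IsSmallestEigenvalue G (-m)) (hm3 : 3 ≤ m)
    (hk : m ^ 2 ≤ (b 0 : ℝ)) :
    ∃ (𝒞 : Finset (Finset V)) (L r : ℕ), IsLineSystem G 𝒞 L r ∧ (r : ℝ) = m ∧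
      (r * (L - 1) : ℝ) = b 0 := by
  obtain ⟨θ, hθ, 𝒞, hD, hE⟩ := hG
  obtain rfl : θ = -m := hθ.unique hm
  have hm0 : 0 < m := by linarith
  have hcard : ∀ C ∈ 𝒞, (#C : ℝ) = 1 + b 0 / m := by
    intro C hC
    rw [(hD C hC).2, div_neg, sub_neg_eq_add]
  -- The hypothesis `m ^ 2 ≤ k` enters here; it yields `r < L`, as `L = 1 + k / m`.
  have hkm : m ≤ b 0 / m := by
    rw [le_div_iff₀ hm0]
    nlinarith
  obtain ⟨v, w, hvw⟩ := h.exists_dist_eq (i := 1) (by omega)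
  rw [SimpleGraph.dist_eq_one_iff_adj] at hvw
  obtain ⟨C₀, ⟨hC₀, -⟩, -⟩ := hE v w hvw
  have hL : ∀ C ∈ 𝒞, #C = #C₀ := by
    intro C hC
    have := (hcard C hC).trans (hcard C₀ hC₀).symm
    exact_mod_cast this
  have hLR := hcard C₀ hC₀
  have hlines : ∀ x, (#{C ∈ 𝒞.toFinset | x ∈ C} : ℝ) = m := by
    intro x
    -- The lines through `x`, with `x` removed, partition its neighbourhood into parts of size `k /
    -- m`; hence there are `m` of them.
    have h1 : ({y | G.Adj x y} : Finset V) =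
        ({C ∈ 𝒞.toFinset | x ∈ C} : Finset (Finset V)).biUnion (fun C => C.erase x) := by
      ext y
      simp only [mem_filter, mem_univ, true_and, mem_biUnion, mem_erase, Set.mem_toFinset]
      constructor
      · intro hxy
        obtain ⟨C, ⟨hC, hx, hy⟩, -⟩ := hE x y hxy
        exact ⟨C, ⟨hC, hx⟩, hxy.ne', hy⟩
      · rintro ⟨C, ⟨hC, hx⟩, hyx, hy⟩
        exact (hD C hC).1 (mem_coe.2 hx) (mem_coe.2 hy) (Ne.symm hyx)
    have h2 : b 0 = #{C ∈ 𝒞.toFinset | x ∈ C} * (#C₀ - 1) := by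
      rw [← h.degree_eq x, h1, card_biUnion, ← smul_eq_mul, ← sum_const]
      · refine sum_congr rfl fun C hC => ?_
        rw [mem_filter, Set.mem_toFinset] at hC
        rw [card_erase_of_mem hC.2, hL C hC.1]
      · intro C hC D hD' hCD
        rw [mem_coe, mem_filter, Set.mem_toFinset] at hC hD'
        rw [Function.onFun, disjoint_left]
        intro y hy hy'
        rw [mem_erase] at hy hy'
        have hadj : G.Adj x y :=
          (hD C hC.1).1 (mem_coe.2 hC.2) (mem_coe.2 hy.2) (Ne.symm hy.1)
        exact hCD ((hE x y hadj).unique ⟨hC.1, hC.2, hy.2⟩ ⟨hD'.1, hD'.2, hy'.2⟩)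
    have h3 : ((#C₀ - 1 : ℕ) : ℝ) = b 0 / m := by
      rw [Nat.cast_sub, hLR]
      · simp
      · have : (1 : ℝ) ≤ #C₀ := by rw [hLR]; linarith
        exact_mod_cast this
    have h4 : (b 0 : ℝ) = #{C ∈ 𝒞.toFinset | x ∈ C} * (b 0 / m) := by
      rw [← h3]
      exact_mod_cast h2
    have hpos : (0 : ℝ) < b 0 / m := by linarith
    refine mul_right_cancel₀ hpos.ne' (h4.symm.trans ?_)
    field_simp
  have hr : ∀ x, #{C ∈ 𝒞.toFinset | x ∈ C} = #{C ∈ 𝒞.toFinset | v ∈ C} := by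
    intro x
    have := (hlines x).trans (hlines v).symm
    exact_mod_cast this
  refine ⟨𝒞.toFinset, #C₀, #{C ∈ 𝒞.toFinset | v ∈ C}, ⟨?_, ?_, ?_, hr, ?_, ?_, ?_⟩, hlines v, ?_⟩
  · intro C hC
    exact (hD C (Set.mem_toFinset.1 hC)).1
  · intro C hC
    exact hL C (Set.mem_toFinset.1 hC)
  · simpa only [Set.mem_toFinset] using hE
  · have : (#{C ∈ 𝒞.toFinset | v ∈ C} : ℝ) < #C₀ := by
      rw [hlines, hLR]
      linarith
    exact_mod_cast this
  · have : (2 : ℝ) ≤ #{C ∈ 𝒞.toFinset | v ∈ C} := by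
      rw [hlines]
      linarith
    exact_mod_cast this
  · intro x y hxy hnadj p q hxp hyp hxq hyq
    have h2 : G.dist x y = 2 := by
      have e1 := h.connected.one_lt_dist_of_ne_of_not_adj hxy hnadj
      have e2 := hyp.symm.diff_dist_adj (u := x)
      rw [SimpleGraph.dist_eq_one_iff_adj.2 hxp] at e2
      omega
    have h3 := h.card_c x y
    rw [h2, hc2, Set.ncard_eq_one] at h3
    obtain ⟨z, hz⟩ := h3
    have mem : ∀ p, G.Adj x p → G.Adj y p → p = z := by
      intro p hxp hyp
      have : p ∈ ({z} : Set V) := by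
        rw [← hz]
        exact ⟨hyp, by rw [SimpleGraph.dist_eq_one_iff_adj.2 hxp]⟩
      exact this
    rw [mem p hxp hyp, mem q hxq hyq]
  · rw [hlines, hLR]
    field_simp
    ring

/-- The motion is an extended natural number, so the real bound passes through its ceiling; without
nonidentity automorphisms the infimum is `⊤`. -/
theorem ofReal_le_motion {V : Type*} [Fintype V] {G : SimpleGraph V} {x : ℝ}
    (H : ∀ σ : G ≃g G, ∀ v, σ v ≠ v → x ≤ ({v | σ v ≠ v} : Set V).ncard) :
    ENNReal.ofReal x ≤ ((motion G : ℕ∞) : ENNReal) := by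
  have h1 : ((⌈x⌉₊ : ℕ) : ℕ∞) ≤ motion G := by
    refine le_iInf fun σ => le_iInf fun hσ => ?_
    obtain ⟨v, hv⟩ : ∃ v, σ v ≠ v := by
      by_contra! hall
      exact hσ (RelIso.ext hall)
    rw [← (Set.toFinite _).cast_ncard_eq]
    exact_mod_cast Nat.ceil_le.2 (H σ v hv)
  calc ENNReal.ofReal x ≤ ((⌈x⌉₊ : ℕ) : ENNReal) := by
        rw [← ENNReal.ofReal_natCast]
        exact ENNReal.ofReal_le_ofReal (Nat.le_ceil x)
    _ = (((⌈x⌉₊ : ℕ) : ℕ∞) : ENNReal) := by simp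
    _ ≤ _ := by exact_mod_cast h1

theorem theorem5p7 (d : ℕ) (hd : 2 ≤ d) :
    (∃ ε η : ℝ, η < 1 / 2 ∧ AreSpectralGapConstants.{u} d ε η) ∧
    ∀ ε η : ℝ, η < 1 / 2 → AreSpectralGapConstants.{u} d ε η →
      ∀ (V : Type u) [Fintype V] (G : SimpleGraph V) (a b c : ℕ → ℕ) (m : ℝ) (t : ℕ),
        IsDistanceRegular G d a b c →
        IsGeometric G (b 0) →
        c 2 = 1 →
        IsSmallestEigenvalue G (-m) →
        3 ≤ m →
        1 ≤ t → t ≤ d →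
        (c t : ℝ) ≤ ε * b 0 →
        (b t : ℝ) ≤ ε * b 0 →
        max (4 * m / η) (m ^ 2) ≤ (b 0 : ℝ) →
        ENNReal.ofReal (η / 4 * Fintype.card V) ≤ ((motion G : ℕ∞) : ENNReal) := by
  refine ⟨exists_areSpectralGapConstants d (by omega), ?_⟩
  intro ε η hη ⟨_, hη0, hgap⟩ V _ G a b c m t h hG hc2 hm hm3 _ htd hct hbt hmax
  classical
  have hkη : 4 * m ≤ b 0 * η := (div_le_iff₀ hη0).1 ((le_max_left _ _).trans hmax)
  have hξ : zeroWeightSpectralRadius G ≤ (b 0 : ℝ) * (1 - η) := by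
    refine (hgap V G a b c h).resolve_left ?_
    -- By monotonicity, `c` is small at all indices up to `t` and `b` is small from `t` on, which
    -- excludes alternative (1).
    rintro ⟨i, hid, hbi, hci⟩
    rcases lt_or_ge i t with hit | hti
    · have : (c (i + 1) : ℝ) ≤ c t := by exact_mod_cast h.c_mono hit htd
      linarith
    · have : (b i : ℝ) ≤ b t := by exact_mod_cast h.b_anti hti hid.le
      linarith
  obtain ⟨𝒞, L, r, hlines, hr, hrL⟩ :=
    hG.exists_isLineSystem h hd hc2 hm hm3 ((le_max_right _ _).trans hmax)
  refine ofReal_le_motion fun σ v hv => ?_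
  have key := hlines.mul_card_le_card_moved hrL (θ := b 0 * (1 - η)) (by rw [hr]; linarith)
    (fun f => by convert h.sum_mul_sum_adj_le hξ f) hv
  rw [Set.ncard_eq_toFinset_card', Set.toFinset_ofPred]
  -- Since `η < 1 / 2`, the factor `η / 4` is below `1 / 8`, hence below `3 / 16`.
  have h1 : η / 4 * (Fintype.card V : ℝ) ≤ 3 / 16 * Fintype.card V :=
    mul_le_mul_of_nonneg_right (by linarith) (Nat.cast_nonneg _)
  refine h1.trans (key.trans_eq ?_)
  congr!
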